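/- Let $M$ be a compact smooth surface without boundary (not necessarily connected), equipped with a smooth Riemannian metric and the induced distance, and let $\varphi:M\to M$ be a $C^2$-diffeomorphism. Let $\Lambda\subset M$ be a horseshoe of $\varphi$, i.e. a non-empty compact set with $\varphi(\Lambda)=\Lambda$ such that: - $\Lambda$ is hyperbolic of saddle type: there are a splitting $T_xM=E^s_x\oplus E^u_x$, $x\in\Lambda$, into one-dimensional subspaces with $D\varphi_x(E^s_x)=E^s_{\varphi(x)}$ and $D\varphi_x(E^u_x)=E^u_{\varphi(x)}$, and constants $C>0$, $0<\lambda<1$ with $\|D(\varphi^n)_xv\|\le C\lambda^n\|v\|$ for $v\in E^s_x$ and $\|D(\varphi^{-n})_xv\|\le C\lambda^n\|v\|$ for $v\in E^u_x$, for all $x\in\Lambda$ and all integers $n\ge 0$; - $\Lambda$ is transitive: some $x\in\Lambda$ has a forward orbit that is dense in $\Lambda$; - $\Lambda$ is locally maximal: $\Lambda=\bigcap_{n\in\mathbb Z}\varphi^n(U)$ for some open set $U\supset\Lambda$; - $\Lambda$ is not a single periodic orbit. Fix $r\ge 2$ (an integer or $\infty$) and put $$\mathcal R_{\varphi,\Lambda}=\{f\in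 C^r(M,\mathbb R):\ \text{for every }x\in\Lambda,\ \nabla f(x)\text{ is neither perpendicular to }E^s_x\text{ nor perpendicular to }E^u_x\}.$$ If the Hausdorff dimension of $\Lambda$ satisfies $\dim(\Lambda)<1$, then $\mathcal R_{\varphi,\Lambda}$ is open and dense in $C^r(M,\mathbb R)$ with respect to the $C^r$ topology, i.e. the topology of uniform convergence, on compact sets in smooth charts, of all derivatives of order at most $r$ (of all finite orders if $r=\infty$). -/

import Mathlib

open Bundle
open scoped Manifold ContDiff Topology

noncomputable section

namespace SurfaceHorseshoe

variable {M : Type*} [EMetricSpace M] [ChartedSpace (EuclideanSpace ℝ (Fin 2)) M]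

/-- A hyperbolic splitting of saddle type over `Λ` for a `C²` diffeomorphism `φ` of a Riemannian
surface: an invariant splitting `T_x M = E^s_x ⊕ E^u_x` over `x ∈ Λ` into lines, the first of which
is uniformly contracted by the forward iterates of `φ` and the second by the backward iterates.
The values of `Es` and `Eu` outside `Λ` play no role. -/
structure IsSaddleSplitting [RiemannianBundle (fun x : M => TangentSpace (𝓡 2) x)]
    (φ : M ≃ₘ^2⟮𝓡 2, 𝓡 2⟯ M) (Λ : Set M)
    (Es Eu : (x : M) → Submodule ℝ (TangentSpace (𝓡 2) x)) : Prop where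
  isCompl : ∀ x ∈ Λ, IsCompl (Es x) (Eu x)
  finrank_stable : ∀ x ∈ Λ, Module.finrank ℝ (Es x) = 1
  finrank_unstable : ∀ x ∈ Λ, Module.finrank ℝ (Eu x) = 1
  map_stable : ∀ x ∈ Λ, (Es x).map (mfderiv (𝓡 2) (𝓡 2) φ x).toLinearMap = Es (φ x)
  map_unstable : ∀ x ∈ Λ, (Eu x).map (mfderiv (𝓡 2) (𝓡 2) φ x).toLinearMap = Eu (φ x)
  contraction : ∃ C lam : ℝ, 0 < C ∧ 0 < lam ∧ lam < 1 ∧ ∀ x ∈ Λ, ∀ n : ℕ,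
    (∀ v ∈ Es x, ‖mfderiv (𝓡 2) (𝓡 2) (φ^[n]) x v‖ ≤ C * lam ^ n * ‖v‖) ∧
    (∀ v ∈ Eu x, ‖mfderiv (𝓡 2) (𝓡 2) (φ.symm^[n]) x v‖ ≤ C * lam ^ n * ‖v‖)

/-- A horseshoe of `φ`: a nonempty compact invariant hyperbolic set of saddle type which is
transitive, locally maximal, and not reduced to a periodic orbit. -/
structure IsHorseshoe [RiemannianBundle (fun x : M => TangentSpace (𝓡 2) x)]
    (φ : M ≃ₘ^2⟮𝓡 2, 𝓡 2⟯ M) (Λ : Set M) : Prop where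
  nonempty : Λ.Nonempty
  isCompact : IsCompact Λ
  invariant : φ '' Λ = Λ
  hyperbolic : ∃ Es Eu : (x : M) → Submodule ℝ (TangentSpace (𝓡 2) x),
    IsSaddleSplitting φ Λ Es Eu
  transitive : ∃ x ∈ Λ, Λ ⊆ closure (Set.range fun n : ℕ => φ^[n] x)
  locallyMaximal : ∃ U : Set M, IsOpen U ∧ Λ ⊆ U ∧
    Λ = {x | ∀ n : ℕ, φ^[n] x ∈ U ∧ φ.symm^[n] x ∈ U}
  not_periodicOrbit : ∀ x ∈ Function.periodicPts φ, Λ ≠ Set.range fun n : ℕ => φ^[n] x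

/-- The Riemannian gradient of `f` at `x`: the tangent vector representing the differential of `f`
at `x` through the inner product of `T_x M`. -/
def gradientAt [RiemannianBundle (fun x : M => TangentSpace (𝓡 2) x)]
    (f : M → ℝ) (x : M) : TangentSpace (𝓡 2) x :=
  haveI : FiniteDimensional ℝ (TangentSpace (𝓡 2) x) :=
    inferInstanceAs (FiniteDimensional ℝ (EuclideanSpace ℝ (Fin 2)))
  haveI : CompleteSpace (TangentSpace (𝓡 2) x) := FiniteDimensional.complete ℝ _
  (InnerProductSpace.toDual ℝ (TangentSpace (𝓡 2) x)).symm (mfderiv (𝓡 2) 𝓘(ℝ, ℝ) f x)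

/-- The `C^r` functions on `M` whose gradient is, at every point `x ∈ Λ`, neither perpendicular to
`E^s_x` nor perpendicular to `E^u_x`. -/
def nonPerpendicularFunctions [RiemannianBundle (fun x : M => TangentSpace (𝓡 2) x)]
    (r : ℕ∞) (Λ : Set M) (Es Eu : (x : M) → Submodule ℝ (TangentSpace (𝓡 2) x)) :
    Set C^r⟮𝓡 2, M; 𝓘(ℝ, ℝ), ℝ⟯ :=
  {f | ∀ x ∈ Λ, gradientAt f x ∉ (Es x)ᗮ ∧ gradientAt f x ∉ (Eu x)ᗮ}

/-- The `C^r` topology on `C^r(M, ℝ)`: uniform convergence of all derivatives of order at most `r`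
(of every finite order if `r = ∞`), read in smooth charts, on compact subsets of chart images. -/
@[reducible] def crTopology (M : Type*) [EMetricSpace M] [ChartedSpace (EuclideanSpace ℝ (Fin 2)) M] (r : ℕ∞) :
    TopologicalSpace C^r⟮𝓡 2, M; 𝓘(ℝ, ℝ), ℝ⟯ :=
  ⨅ e ∈ IsManifold.maximalAtlas (𝓡 2) ∞ M, ⨅ (k : ℕ) (_ : (k : ℕ∞) ≤ r),
    TopologicalSpace.induced
      (fun f => UniformOnFun.ofFun {K : Set (EuclideanSpace ℝ (Fin 2)) | IsCompact K ∧ K ⊆ e.target}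
        (iteratedFDerivWithin ℝ k (f ∘ e.symm) e.target))
      inferInstance

end SurfaceHorseshoe

end

/-! The gradient of `f` is not perpendicular to a line exactly when `df` does not vanish on it, so
the set in question consists of the `f` whose differential is nonzero on all stable and all unstable
lines over `Λ`. Passing to the inverse of `φ` exchanges the two families, so only stable lines need
study.

The crux is that `x ↦ E^s_x` is Lipschitz on `Λ`. To compare tangent spaces at different points,
covectors are pulled back from a vector space by an immersion `G`: if `β ∘ dG` kills `E^s_x`, it
should be `O(d(x, y))` on `E^s_y`. Apply a high iterate `ψ` of `φ`. Since `E^u_x` is a line, `Dψ`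
stretches it by a single rate `m`; the covector shrinks by about `1/m`, the distance grows by at
most about `m`, and vectors of `E^s_y` shrink by `σ`. The rate `m` cancels, leaving a factor of
order `σ`, at most `1/2` for a suitable iterate. The error from comparing the covectors is linear in
the distance because `ψ` is `C²`, and iteration sums a geometric series
(`IsContractingSplitting.exists_lipschitz`).

Openness: `df` is then bounded below on stable lines over a compact set, which survives a `C¹`-small
perturbation. Density: where `dg` is bounded below on stable lines, the ratio `t(x)` of `df` to `dg`
on `E^s_x` is Lipschitz, so its image has dimension less than one and dense complement in `ℝ`; for
arbitrarily small `τ` outside the image, `f - τ g` is transversal. Such a `g` exists near each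
point, and compactness with openness glues the local results. -/

noncomputable section

namespace SurfaceHorseshoe

open Set MeasureTheory Filter
open scoped ENNReal NNReal

/-! ### Distances and path lengths. -/

section Paths

variable {E : Type*} [NormedAddCommGroup E] [NormedSpace ℝ E]
  {H : Type*} [TopologicalSpace H] {I : ModelWithCorners ℝ E H}
  {M : Type*} [PseudoEMetricSpace M] [ChartedSpace H M]
  [RiemannianBundle (fun x : M => TangentSpace I x)] [IsRiemannianManifold I M]
  {E' : Type*} [NormedAddCommGroup E'] [NormedSpace ℝ E']
  {H' : Type*} [TopologicalSpace H'] {I' : ModelWithCorners ℝ E' H'}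
  {M' : Type*} [PseudoEMetricSpace M'] [ChartedSpace H' M']
  [RiemannianBundle (fun x : M' => TangentSpace I' x)] [IsRiemannianManifold I' M']

/-- A map whose differential is bounded by `K` along the ball of radius `s` around `x` multiplies
the distance from `x` to the points of this ball by at most `K`. -/
lemma edist_map_lt_of_enorm_mfderiv_le {F : M → M'} {U : Set M} (hU : IsOpen U)
    (hF : ContMDiffOn I I' 1 F U) {x y : M} {s K : ℝ≥0} (hK : 0 < K)
    (hball : ∀ z, edist x z < s → z ∈ U)
    (hD : ∀ z, edist x z < s → ∀ v : TangentSpace I z, ‖mfderiv I I' F z v‖ₑ ≤ K * ‖v‖ₑ)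
    (hxy : edist x y < s) : edist (F x) (F y) < K * s := by
  rw [IsRiemannianManifold.out (I := I) x y] at hxy
  obtain ⟨γ, h0, h1, hγ, hlen⟩ := Manifold.exists_lt_of_riemannianEDist_lt hxy
  -- A path of length less than `s` starting at `x` cannot leave the ball of radius `s`, so the
  -- bound on the differential holds all along it.
  have hmem : ∀ t ∈ Icc (0 : ℝ) 1, edist x (γ t) < s := by
    intro t ht
    rw [IsRiemannianManifold.out (I := I) x (γ t)]
    refine lt_of_le_of_lt ?_ hlen
    exact (Manifold.riemannianEDist_le_pathELength
      (hγ.mono (Icc_subset_Icc_right ht.2)) h0 rfl ht.1).trans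
      (Manifold.pathELength_mono le_rfl ht.2)
  have hcomp : ContMDiffOn 𝓘(ℝ, ℝ) I' 1 (F ∘ γ) (Icc 0 1) :=
    hF.comp hγ fun t ht => hball _ (hmem t ht)
  rw [IsRiemannianManifold.out (I := I') (F x) (F y)]
  calc Manifold.riemannianEDist I' (F x) (F y)
      ≤ Manifold.pathELength I' (F ∘ γ) 0 1 :=
        Manifold.riemannianEDist_le_pathELength hcomp (by simp [h0]) (by simp [h1]) zero_le_one
    _ ≤ K * Manifold.pathELength I γ 0 1 := by
        rw [Manifold.pathELength_eq_lintegral_mfderivWithin_Icc,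
          Manifold.pathELength_eq_lintegral_mfderivWithin_Icc,
          ← lintegral_const_mul' _ _ ENNReal.coe_ne_top]
        refine setLIntegral_mono' measurableSet_Icc fun t ht => ?_
        have hz := hmem t ht
        have : mfderiv[Icc 0 1] (F ∘ γ) t = (mfderiv I I' F (γ t)) ∘L (mfderiv[Icc 0 1] γ t) := by
          apply mfderiv_comp_mfderivWithin
          · exact ((hF.contMDiffAt (hU.mem_nhds (hball _ hz))).mdifferentiableAt one_ne_zero)
          · exact hγ.mdifferentiableOn one_ne_zero t ht
          · rw [uniqueMDiffWithinAt_iff_uniqueDiffWithinAt]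
            exact uniqueDiffOn_Icc zero_lt_one t ht
        have h2 : mfderiv[Icc 0 1] (F ∘ γ) t 1 =
            (mfderiv I I' F (γ t)) (mfderiv[Icc 0 1] γ t 1) := congr($this 1)
        rw [h2]
        exact hD _ hz _
    _ < K * s := by
        gcongr
        exact ENNReal.coe_ne_top

end Paths

/-! ### Factoring functionals. -/

section HahnBanach

/-- A linear functional dominated by the norm of a linear map factors through this linear map. -/
lemma exists_dual_comp_eq {V W : Type*} [AddCommGroup V] [Module ℝ V] [NormedAddCommGroup W]
    [NormedSpace ℝ W] (L : V →ₗ[ℝ] W) (α : V →ₗ[ℝ] ℝ) {R : ℝ} (hR : 0 ≤ R)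
    (h : ∀ v, |α v| ≤ R * ‖L v‖) :
    ∃ β : W →L[ℝ] ℝ, (∀ v, β (L v) = α v) ∧ ‖β‖ ≤ R := by
  have hker : ∀ v w, L v = L w → α v = α w := by
    intro v w hvw
    have := h (v - w)
    rw [map_sub, map_sub, hvw, sub_self, norm_zero, mul_zero] at this
    exact sub_eq_zero.1 (abs_eq_zero.1 (le_antisymm this (abs_nonneg _)))
  obtain ⟨g, hg⟩ := L.rangeRestrict.exists_rightInverse_of_surjective L.range_rangeRestrict
  have hg' : ∀ w : LinearMap.range L, L (g w) = w := fun w =>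
    congrArg Subtype.val (LinearMap.congr_fun hg w)
  -- The functional is defined on the range of `L` with norm at most `R`; Hahn–Banach extends it
  -- without increasing the norm.
  let a : StrongDual ℝ (LinearMap.range L) := (α ∘ₗ g).mkContinuous R fun w => by
    simpa [hg'] using h (g w)
  obtain ⟨β, hβ, hn⟩ := exists_extension_norm_eq (LinearMap.range L) a
  refine ⟨β, fun v => ?_, hn.trans_le (LinearMap.mkContinuous_norm_le _ hR _)⟩
  rw [hβ ⟨L v, LinearMap.mem_range_self L v⟩]
  exact hker _ _ (hg' _)

end HahnBanach

/-- Monotonicity in the constant lets finitely many local constants be replaced by their maximum. -/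
lemma exists_forall_of_eventually {X : Type*} [TopologicalSpace X] {K : Set X} (hK : IsCompact K)
    {P : X → ℝ → Prop} (hmono : ∀ x C C', C ≤ C' → P x C → P x C')
    (hloc : ∀ x ∈ K, ∃ C, ∀ᶠ y in 𝓝[K] x, P y C) : ∃ C, ∀ y ∈ K, P y C := by
  refine hK.induction_on (p := fun s => ∃ C, ∀ y ∈ s, P y C) ⟨0, by simp⟩ ?_ ?_ ?_
  · rintro s t hst ⟨C, hC⟩
    exact ⟨C, fun y hy => hC y (hst hy)⟩
  · rintro s t ⟨C, hC⟩ ⟨C', hC'⟩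
    refine ⟨max C C', ?_⟩
    rintro y (hy | hy)
    · exact hmono _ _ _ (le_max_left _ _) (hC y hy)
    · exact hmono _ _ _ (le_max_right _ _) (hC' y hy)
  · intro x hx
    obtain ⟨C, hC⟩ := hloc x hx
    exact ⟨_, hC, C, fun y hy => hy⟩

/-! ### Local bounds on differentials in charts. -/

section LocalBounds

variable {M : Type*} [EMetricSpace M] [ChartedSpace (EuclideanSpace ℝ (Fin 2)) M]
  {F : Type*} [NormedAddCommGroup F] [NormedSpace ℝ F]

/-- The differential of a vector valued function, as a map with values in the vector space. -/
def differential (h : M → F) (x : M) : TangentSpace (𝓡 2) x →L[ℝ] F :=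
  mfderiv (𝓡 2) 𝓘(ℝ, F) h x

section Charts

variable [IsManifold (𝓡 2) ∞ M]

lemma contDiffOn_comp_extChartAt_symm {h : M → F} {n : ℕ∞}
    (hh : ContMDiff (𝓡 2) 𝓘(ℝ, F) n h) (p : M) :
    ContDiffOn ℝ n (h ∘ (extChartAt (𝓡 2) p).symm) (extChartAt (𝓡 2) p).target := by
  rw [← contMDiffOn_iff_contDiffOn]
  have : IsManifold (𝓡 2) n M := IsManifold.of_le (n := ∞) (by exact_mod_cast le_top)
  exact hh.comp_contMDiffOn (contMDiffOn_extChartAt_symm p)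

lemma contDiffAt_comp_extChartAt_symm {h : M → F} {n : ℕ∞}
    (hh : ContMDiff (𝓡 2) 𝓘(ℝ, F) n h) (p : M) {y : M}
    (hy : y ∈ (extChartAt (𝓡 2) p).source) :
    ContDiffAt ℝ n (h ∘ (extChartAt (𝓡 2) p).symm) (extChartAt (𝓡 2) p y) :=
  (contDiffOn_comp_extChartAt_symm hh p).contDiffAt
    ((isOpen_extChartAt_target p).mem_nhds ((extChartAt (𝓡 2) p).map_source hy))

/-- Reads the differential at every point of one chart domain in the same vector space, so that
differentials at different points can be subtracted. -/
lemma differential_eq_fderiv_comp {h : M → F}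
    (hh : ContMDiff (𝓡 2) 𝓘(ℝ, F) 1 h) (p : M) {y : M}
    (hy : y ∈ (extChartAt (𝓡 2) p).source) (v : TangentSpace (𝓡 2) y) :
    differential h y v = fderiv ℝ (h ∘ (extChartAt (𝓡 2) p).symm) (extChartAt (𝓡 2) p y)
      (differential (extChartAt (𝓡 2) p) y v) := by
  have h1 : h =ᶠ[𝓝 y] (h ∘ (extChartAt (𝓡 2) p).symm) ∘ extChartAt (𝓡 2) p := by
    filter_upwards [(isOpen_extChartAt_source p).mem_nhds hy] with z hz
    simp only [Function.comp_apply, (extChartAt (𝓡 2) p).left_inv hz]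
  have h2 := ((contDiffAt_comp_extChartAt_symm (n := 1) hh p hy).differentiableAt
    one_ne_zero).mdifferentiableAt
  have h3 : MDifferentiableAt (𝓡 2) 𝓘(ℝ, EuclideanSpace ℝ (Fin 2)) (extChartAt (𝓡 2) p) y :=
    mdifferentiableAt_extChartAt (by simpa [extChartAt_source] using hy)
  have h4 := mfderiv_comp y h2 h3
  rw [← h1.mfderiv_eq, mfderiv_eq_fderiv] at h4
  exact congr($h4 v)

lemma differential_extChartAt_surjective (p : M) {y : M}
    (hy : y ∈ (extChartAt (𝓡 2) p).source) :
    Function.Surjective (differential (extChartAt (𝓡 2) p) y) :=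
  (isInvertible_mfderiv_extChartAt hy).bijective.2

variable [RiemannianBundle (fun x : M => TangentSpace (𝓡 2) x)]
  [IsContinuousRiemannianBundle (EuclideanSpace ℝ (Fin 2)) (fun x : M => TangentSpace (𝓡 2) x)]

lemma eventually_norm_differential_extChartAt_le (p : M) :
    ∃ C > 0, ∀ᶠ y in 𝓝 p, ∀ v : TangentSpace (𝓡 2) y,
      ‖differential (extChartAt (𝓡 2) p) y v‖ ≤ C * ‖v‖ := by
  obtain ⟨C, hC, h⟩ := eventually_norm_mfderiv_extChartAt_lt (𝓡 2) p
  refine ⟨C, hC, h.mono fun y hy v => ?_⟩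
  exact (ContinuousLinearMap.le_opNorm (differential (extChartAt (𝓡 2) p) y) v).trans
    (by gcongr; exact hy.le)

lemma eventually_norm_le_norm_differential_extChartAt (p : M) :
    ∃ C > 0, ∀ᶠ y in 𝓝 p, ∀ v : TangentSpace (𝓡 2) y,
      ‖v‖ ≤ C * ‖differential (extChartAt (𝓡 2) p) y v‖ := by
  obtain ⟨C, hC, h⟩ := eventually_norm_symmL_trivializationAt_lt (EuclideanSpace ℝ (Fin 2))
    (fun x : M => TangentSpace (𝓡 2) x) p
  refine ⟨C, hC, ?_⟩
  filter_upwards [h, chart_source_mem_nhds (EuclideanSpace ℝ (Fin 2)) p] with y hy hys v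
  have h1 := TangentBundle.continuousLinearMapAt_trivializationAt (I := 𝓡 2) hys
  have h2 := (trivializationAt (EuclideanSpace ℝ (Fin 2)) (TangentSpace (𝓡 2)) p
    ).symmL_continuousLinearMapAt (R := ℝ) (b := y) (by simpa using hys) v
  rw [h1] at h2
  refine (congrArg norm h2.symm).trans_le ((ContinuousLinearMap.le_opNorm _ _).trans ?_)
  exact mul_le_mul_of_nonneg_right hy.le (norm_nonneg _)

lemma exists_norm_extChartAt_sub_lt [IsRiemannianManifold (𝓡 2) M] (p : M) :
    ∃ C > 0, ∃ U ∈ 𝓝 p, ∀ x ∈ U, ∀ y ∈ U, ∀ s : ℝ, edist x y < ENNReal.ofReal s →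
      ‖extChartAt (𝓡 2) p x - extChartAt (𝓡 2) p y‖ < C * s := by
  obtain ⟨C, hC, h⟩ := eventually_norm_differential_extChartAt_le p
  have h' := inter_mem h (extChartAt_source_mem_nhds (I := 𝓡 2) p)
  obtain ⟨ε, hε, hball⟩ := EMetric.mem_nhds_iff.1 h'
  obtain ⟨η, hη, hηε⟩ := ENNReal.lt_iff_exists_nnreal_btwn.1 hε
  have hη0 : 0 < η := by exact_mod_cast hη
  have hlt : ∀ s : ℝ≥0, ∀ x y, edist x p < (η / 2 : ℝ≥0) → s ≤ η / 2 → edist x y < s →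
      ‖extChartAt (𝓡 2) p x - extChartAt (𝓡 2) p y‖ < C * s := by
    intro s x y hx hs hxy
    have hz : ∀ z, edist x z < s → z ∈ Metric.eball p ε := by
      intro z hz
      refine lt_of_le_of_lt (edist_triangle_left z p x) ?_
      refine lt_trans (ENNReal.add_lt_add (hz.trans_le (ENNReal.coe_le_coe.2 hs)) hx) ?_
      rw [← ENNReal.coe_add, add_halves]
      exact hηε
    have hF : ContMDiffOn (𝓡 2) 𝓘(ℝ, EuclideanSpace ℝ (Fin 2)) 1 (extChartAt (𝓡 2) p)
        (extChartAt (𝓡 2) p).source := by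
      rw [extChartAt_source]
      exact contMDiffOn_extChartAt
    have := edist_map_lt_of_enorm_mfderiv_le (isOpen_extChartAt_source p) hF
      (K := C.toNNReal) (by simpa using hC) (fun z hxz => (hball (hz z hxz)).2)
      (fun z hxz v => ?_) hxy
    · rw [← ENNReal.coe_mul, edist_lt_coe, ← NNReal.coe_lt_coe, coe_nndist, dist_eq_norm,
        NNReal.coe_mul, Real.coe_toNNReal _ hC.le] at this
      exact this
    · rw [enorm_tangentSpace_vectorSpace]
      have := (hball (hz z hxz)).1 v
      change ‖differential (extChartAt (𝓡 2) p) z v‖ₑ ≤ _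
      rw [← ofReal_norm, ← ofReal_norm]
      change _ ≤ ENNReal.ofReal C * _
      rw [← ENNReal.ofReal_mul hC.le]
      exact ENNReal.ofReal_le_ofReal this
  have hη2 : 0 < η / 2 := half_pos hη0
  -- With both points within `η / 4` of `p`, their distance is below `η / 2` and the ball of that
  -- radius around `x` stays where the chart differential is bounded. Larger `s` are truncated at `η
  -- / 2`.
  refine ⟨C, hC, Metric.eball p ((η / 2 / 2 : ℝ≥0)),
    Metric.eball_mem_nhds _ (by exact_mod_cast half_pos hη2), ?_⟩
  intro x hx y hy s hs
  have hx' : edist x p < (η / 2 / 2 : ℝ≥0) := hx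
  have hy' : edist y p < (η / 2 / 2 : ℝ≥0) := hy
  have hx2 : edist x p < (η / 2 : ℝ≥0) :=
    hx'.trans_le (ENNReal.coe_le_coe.2 (half_le_self hη2.le))
  have hxy : edist x y < (η / 2 : ℝ≥0) := by
    refine lt_of_le_of_lt (edist_triangle_right x y p) ((ENNReal.add_lt_add hx' hy').trans_eq ?_)
    rw [← ENNReal.coe_add, add_halves]
  have hs0 : 0 < s := by
    by_contra h0
    rw [ENNReal.ofReal_of_nonpos (not_lt.1 h0)] at hs
    exact not_lt_zero hs
  have key := hlt (min s.toNNReal (η / 2)) x y hx2 (min_le_right _ _)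
    (by rw [ENNReal.coe_min]; exact lt_min hs hxy)
  refine key.trans_le (mul_le_mul_of_nonneg_left ?_ hC.le)
  rw [NNReal.coe_min, Real.coe_toNNReal _ hs0.le]
  exact min_le_left _ _

/-- A `C¹` vector valued function has locally bounded differential. -/
lemma eventually_norm_differential_le {h : M → F} (hh : ContMDiff (𝓡 2) 𝓘(ℝ, F) 1 h) (p : M) :
    ∃ C, ∀ᶠ y in 𝓝 p, ∀ v : TangentSpace (𝓡 2) y, ‖differential h y v‖ ≤ C * ‖v‖ := by
  obtain ⟨C, hC, h1⟩ := eventually_norm_differential_extChartAt_le p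
  have hcd := contDiffAt_comp_extChartAt_symm (n := 1) hh p (mem_extChartAt_source p)
  have hcont := (hcd.continuousAt_fderiv one_ne_zero).norm.comp (continuousAt_extChartAt p)
  have hbd := hcont.eventually_lt (continuousAt_const (y := ‖fderiv ℝ
    (h ∘ (extChartAt (𝓡 2) p).symm) (extChartAt (𝓡 2) p p)‖ + 1)) (lt_add_one _)
  refine ⟨(‖fderiv ℝ (h ∘ (extChartAt (𝓡 2) p).symm) (extChartAt (𝓡 2) p p)‖ + 1) * C, ?_⟩
  filter_upwards [h1, extChartAt_source_mem_nhds (I := 𝓡 2) p, hbd] with y hy hys hyb v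
  rw [differential_eq_fderiv_comp hh p hys, mul_assoc]
  exact (ContinuousLinearMap.le_opNorm _ _).trans
    (mul_le_mul hyb.le (hy v) (norm_nonneg _) (by positivity))

/-- The differential of an immersion is locally bounded below. -/
lemma eventually_norm_le_norm_differential {h : M → F} (hh : ContMDiff (𝓡 2) 𝓘(ℝ, F) 1 h)
    (p : M) (hinj : Function.Injective (differential h p)) :
    ∃ C, ∀ᶠ y in 𝓝 p, ∀ v : TangentSpace (𝓡 2) y, ‖v‖ ≤ C * ‖differential h y v‖ := by
  obtain ⟨C, hC, h1⟩ := eventually_norm_le_norm_differential_extChartAt p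
  have hcd := contDiffAt_comp_extChartAt_symm (n := 1) hh p (mem_extChartAt_source p)
  have hinj' : Function.Injective (fderiv ℝ (h ∘ (extChartAt (𝓡 2) p).symm)
      (extChartAt (𝓡 2) p p)) := by
    intro a b hab
    obtain ⟨v, rfl⟩ := differential_extChartAt_surjective p (mem_extChartAt_source p) a
    obtain ⟨w, rfl⟩ := differential_extChartAt_surjective p (mem_extChartAt_source p) b
    rw [← differential_eq_fderiv_comp hh p (mem_extChartAt_source p),
      ← differential_eq_fderiv_comp hh p (mem_extChartAt_source p)] at hab
    rw [hinj hab]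
  obtain ⟨K, hK, hanti⟩ := (LinearMap.injective_iff_antilipschitz
    (fderiv ℝ (h ∘ (extChartAt (𝓡 2) p).symm) (extChartAt (𝓡 2) p p)).toLinearMap).1 hinj'
  have hK' : (0 : ℝ) < K := hK
  have hcont : Tendsto (fun y => ‖fderiv ℝ (h ∘ (extChartAt (𝓡 2) p).symm) (extChartAt (𝓡 2) p y) -
      fderiv ℝ (h ∘ (extChartAt (𝓡 2) p).symm) (extChartAt (𝓡 2) p p)‖) (𝓝 p) (𝓝 0) := by
    have := ((hcd.continuousAt_fderiv one_ne_zero).comp (continuousAt_extChartAt p)).tendsto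
    exact tendsto_iff_norm_sub_tendsto_zero.1 this
  -- The derivative at `p` is bounded below by `1 / K`; a perturbation smaller than half of this
  -- keeps the lower bound `1 / (2K)`.
  have hbd := hcont.eventually_lt_const (show (0 : ℝ) < 1 / (2 * K) by positivity)
  refine ⟨C * (2 * K), ?_⟩
  filter_upwards [h1, extChartAt_source_mem_nhds (I := 𝓡 2) p, hbd] with y hy hys hyb v
  rw [differential_eq_fderiv_comp hh p hys, mul_assoc]
  refine (hy v).trans (mul_le_mul_of_nonneg_left ?_ hC.le)
  set w := differential (extChartAt (𝓡 2) p) y v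
  set A := fderiv ℝ (h ∘ (extChartAt (𝓡 2) p).symm) (extChartAt (𝓡 2) p y)
  set A0 := fderiv ℝ (h ∘ (extChartAt (𝓡 2) p).symm) (extChartAt (𝓡 2) p p)
  have e1 : ‖w‖ ≤ K * ‖A0 w‖ := by
    have := hanti.le_mul_dist w 0
    simpa using this
  have e2 : ‖A0 w‖ ≤ ‖A w‖ + 1 / (2 * K) * ‖w‖ := by
    have : A0 w = A w - (A - A0) w := by simp
    rw [this]
    refine (norm_sub_le _ _).trans (add_le_add le_rfl ?_)
    exact (ContinuousLinearMap.le_opNorm _ _).trans (by gcongr)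
  have e3 : (K : ℝ) * (1 / (2 * K) * ‖w‖) = ‖w‖ / 2 := by field_simp
  nlinarith [mul_le_mul_of_nonneg_left e2 hK'.le]

/-- The pairs `(x, y)` at which a covector of the form `b ∘ dh` vanishing at `x` has norm at
most `C ‖b‖ d(x, y)` at `y`. -/
def DifferentialLipschitzAt (h : M → F) (x y : M) (C : ℝ) : Prop :=
  ∀ s : ℝ, edist x y < ENNReal.ofReal s → ∀ b : F →L[ℝ] ℝ,
    (∀ v, b (differential h x v) = 0) →
      ∀ v, |b (differential h y v)| ≤ C * ‖b‖ * s * ‖v‖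

/-- In a chart the derivative of a `C²` map is Lipschitz; as `b` kills the derivative at `x`, only
the difference of the two derivatives contributes at `y`. -/
lemma eventually_differentialLipschitzAt [IsRiemannianManifold (𝓡 2) M] {h : M → F}
    (hh : ContMDiff (𝓡 2) 𝓘(ℝ, F) 2 h) (p : M) :
    ∃ C, ∀ᶠ q : M × M in 𝓝 (p, p), DifferentialLipschitzAt h q.1 q.2 C := by
  have hh1 : ContMDiff (𝓡 2) 𝓘(ℝ, F) 1 h := hh.of_le one_le_two
  obtain ⟨C, hC, h1⟩ := eventually_norm_differential_extChartAt_le p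
  obtain ⟨C', hC', U, hU, hlip⟩ := exists_norm_extChartAt_sub_lt p
  have hcd := contDiffAt_comp_extChartAt_symm (n := 2) hh p (mem_extChartAt_source p)
  obtain ⟨K, t, ht, hKt⟩ :=
    (hcd.fderiv_right (m := 1) (by norm_num)).exists_lipschitzOnWith
  have ht' : extChartAt (𝓡 2) p ⁻¹' t ∈ 𝓝 p := (continuousAt_extChartAt p).preimage_mem_nhds ht
  refine ⟨K * C' * C, ?_⟩
  have hall := inter_mem (inter_mem h1 hU) (inter_mem ht'
    (extChartAt_source_mem_nhds (I := 𝓡 2) p))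
  rw [nhds_prod_eq]
  filter_upwards [prod_mem_prod hall hall]
  rintro ⟨x, y⟩ ⟨⟨⟨-, hxU⟩, hxt, hxs⟩, ⟨⟨hy1, hyU⟩, hyt, hys⟩⟩ s hs b hb v
  rw [differential_eq_fderiv_comp hh1 p hys]
  -- The vector at `x` with the same chart coordinates as `v` at `y`.
  obtain ⟨u, hu⟩ := differential_extChartAt_surjective p hxs
    (differential (extChartAt (𝓡 2) p) y v : EuclideanSpace ℝ (Fin 2))
  have hx0 := hb u
  rw [differential_eq_fderiv_comp hh1 p hxs, hu] at hx0
  set w := differential (extChartAt (𝓡 2) p) y v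
  have hd := hKt.norm_sub_le hyt hxt
  rw [norm_sub_rev (extChartAt (𝓡 2) p y)] at hd
  have hd' := hlip x hxU y hyU s hs
  set A := fderiv ℝ (h ∘ (extChartAt (𝓡 2) p).symm) (extChartAt (𝓡 2) p y)
  set A0 := fderiv ℝ (h ∘ (extChartAt (𝓡 2) p).symm) (extChartAt (𝓡 2) p x)
  have hs0 : 0 < s := by
    by_contra h0
    rw [ENNReal.ofReal_of_nonpos (not_lt.1 h0)] at hs
    exact not_lt_zero hs
  calc |b (A w)| = ‖b ((A - A0) w)‖ := by simp [hx0]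
    _ ≤ ‖b‖ * (‖A - A0‖ * ‖w‖) := (b.le_opNorm _).trans
        (mul_le_mul_of_nonneg_left (ContinuousLinearMap.le_opNorm _ _) (norm_nonneg _))
    _ ≤ ‖b‖ * ((K * (C' * s)) * (C * ‖v‖)) := by
        have : ‖w‖ ≤ C * ‖v‖ := hy1 v
        gcongr
        exact hd.trans (mul_le_mul_of_nonneg_left hd'.le K.2)
    _ = K * C' * C * ‖b‖ * s * ‖v‖ := by ring

end Charts

end LocalBounds

lemma pos_of_edist_lt_ofReal {X : Type*} [PseudoEMetricSpace X] {x y : X} {s : ℝ}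
    (h : edist x y < ENNReal.ofReal s) : 0 < s :=
  ENNReal.ofReal_pos.1 (pos_of_gt h)

/-! ### Chain rules. -/

section Differential

variable {M : Type*} [EMetricSpace M] [ChartedSpace (EuclideanSpace ℝ (Fin 2)) M]
  {F : Type*} [NormedAddCommGroup F] [NormedSpace ℝ F]
  {F' : Type*} [NormedAddCommGroup F'] [NormedSpace ℝ F']

lemma differential_comp {h : M → F} {ψ : M → M} (hh : ContMDiff (𝓡 2) 𝓘(ℝ, F) 1 h)
    (hψ : ContMDiff (𝓡 2) (𝓡 2) 1 ψ) (x : M) (v : TangentSpace (𝓡 2) x) :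
    differential (h ∘ ψ) x v = differential h (ψ x) (mfderiv (𝓡 2) (𝓡 2) ψ x v) :=
  congr($(mfderiv_comp x (hh.mdifferentiableAt one_ne_zero)
    (hψ.mdifferentiableAt one_ne_zero)) v)

lemma differential_clm_comp (L : F →L[ℝ] F') {h : M → F} (hh : ContMDiff (𝓡 2) 𝓘(ℝ, F) 1 h)
    (x : M) (v : TangentSpace (𝓡 2) x) :
    differential (fun y => L (h y)) x v = L (differential h x v) := by
  have := mfderiv_comp x L.differentiableAt.mdifferentiableAt
    (hh.mdifferentiableAt (x := x) one_ne_zero)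
  rw [mfderiv_eq_fderiv, L.fderiv] at this
  exact congr($this v)

lemma differential_prodMk {f : M → F} {g : M → F'} (hf : ContMDiff (𝓡 2) 𝓘(ℝ, F) 1 f)
    (hg : ContMDiff (𝓡 2) 𝓘(ℝ, F') 1 g) (x : M) (v : TangentSpace (𝓡 2) x) :
    differential (fun y => (f y, g y)) x v = (differential f x v, differential g x v) := by
  have hfg : ContMDiff (𝓡 2) 𝓘(ℝ, F × F') 1 (fun y => (f y, g y)) := hf.prodMk_space hg
  exact Prod.ext (differential_clm_comp (ContinuousLinearMap.fst ℝ F F') hfg x v).symm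
    (differential_clm_comp (ContinuousLinearMap.snd ℝ F F') hfg x v).symm

end Differential

/-! ### Uniform bounds on the compact surface. -/

section Compact

variable {M : Type*} [EMetricSpace M] [CompactSpace M]
  [ChartedSpace (EuclideanSpace ℝ (Fin 2)) M] [IsManifold (𝓡 2) ∞ M]
  [RiemannianBundle (fun x : M => TangentSpace (𝓡 2) x)]
  [IsContinuousRiemannianBundle (EuclideanSpace ℝ (Fin 2)) (fun x : M => TangentSpace (𝓡 2) x)]
  {F : Type*} [NormedAddCommGroup F] [NormedSpace ℝ F]

lemma exists_norm_differential_le {h : M → F} (hh : ContMDiff (𝓡 2) 𝓘(ℝ, F) 1 h) :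
    ∃ B, 0 ≤ B ∧ ∀ (x : M) (v : TangentSpace (𝓡 2) x), ‖differential h x v‖ ≤ B * ‖v‖ := by
  obtain ⟨C, hC⟩ := exists_forall_of_eventually (isCompact_univ (X := M))
    (P := fun x C => ∀ v : TangentSpace (𝓡 2) x, ‖differential h x v‖ ≤ C * ‖v‖)
    (fun x C C' hCC' hx v => (hx v).trans (by gcongr))
    (fun x _ => by simpa using eventually_norm_differential_le hh x)
  exact ⟨max C 0, le_max_right _ _, fun x v => (hC x (mem_univ x) v).trans
    (by gcongr; exact le_max_left _ _)⟩

lemma exists_norm_le_norm_differential {h : M → F} (hh : ContMDiff (𝓡 2) 𝓘(ℝ, F) 1 h)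
    (hinj : ∀ x, Function.Injective (differential h x)) :
    ∃ c, 0 < c ∧ ∀ (x : M) (v : TangentSpace (𝓡 2) x), ‖v‖ ≤ c * ‖differential h x v‖ := by
  obtain ⟨C, hC⟩ := exists_forall_of_eventually (isCompact_univ (X := M))
    (P := fun x C => ∀ v : TangentSpace (𝓡 2) x, ‖v‖ ≤ C * ‖differential h x v‖)
    (fun x C C' hCC' hx v => (hx v).trans (by gcongr))
    (fun x _ => by simpa using eventually_norm_le_norm_differential hh x (hinj x))
  exact ⟨max C 1, by positivity, fun x v => (hC x (mem_univ x) v).trans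
    (by gcongr; exact le_max_left _ _)⟩

variable [IsRiemannianManifold (𝓡 2) M]

/-- Compactness of `M × M`: near the diagonal the chart estimate applies, and away from it the
distance is bounded below, so boundedness of the differential suffices. -/
lemma exists_differentialLipschitzAt {h : M → F} (hh : ContMDiff (𝓡 2) 𝓘(ℝ, F) 2 h) :
    ∃ C, 0 ≤ C ∧ ∀ x y, DifferentialLipschitzAt h x y C := by
  have hmono : ∀ (x y : M) (C C' : ℝ), C ≤ C' → DifferentialLipschitzAt h x y C →
      DifferentialLipschitzAt h x y C' := by
    intro x y C C' hCC' hC s hs b hb v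
    have := pos_of_edist_lt_ofReal hs
    exact (hC s hs b hb v).trans (by gcongr)
  obtain ⟨B, hB, hBd⟩ := exists_norm_differential_le (hh.of_le one_le_two)
  obtain ⟨C, hC⟩ := exists_forall_of_eventually (isCompact_univ (X := M × M))
    (P := fun q C => DifferentialLipschitzAt h q.1 q.2 C)
    (fun q C C' => hmono q.1 q.2 C C') (fun q _ => by
      rw [nhdsWithin_univ]
      obtain ⟨p, q⟩ := q
      by_cases hpq : p = q
      · subst hpq
        exact eventually_differentialLipschitzAt hh p
      · obtain ⟨δ, hδ, hδ'⟩ := ENNReal.lt_iff_exists_nnreal_btwn.1 (edist_pos.2 hpq)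
        have hδ0 : (0 : ℝ) < δ := by exact_mod_cast hδ
        refine ⟨B / δ, ?_⟩
        filter_upwards [(continuous_edist (α := M)).continuousAt.eventually_const_lt hδ']
          with z hz s hs b _ v
        have hδs : (δ : ℝ) < s := by
          have h1 := hz.trans hs
          rw [← ENNReal.ofReal_coe_nnreal] at h1
          exact (ENNReal.ofReal_lt_ofReal_iff (pos_of_edist_lt_ofReal hs)).1 h1
        calc |b (differential h z.2 v)| ≤ ‖b‖ * (B * ‖v‖) :=
              (b.le_opNorm _).trans (mul_le_mul_of_nonneg_left (hBd _ v) (norm_nonneg _))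
          _ = B / δ * ‖b‖ * δ * ‖v‖ := by field_simp
          _ ≤ B / δ * ‖b‖ * s * ‖v‖ := by gcongr)
  exact ⟨max C 0, le_max_right _ _, fun x y =>
    hmono x y C _ (le_max_left _ _) (hC (x, y) (mem_univ _))⟩

/-- Near `x`, the differential of `ψ` is bounded in terms of its norm at `x`, with a constant
which depends only on the bounds of an auxiliary immersion. -/
lemma exists_norm_mfderiv_le_near {G : M → F} (hG : ContMDiff (𝓡 2) 𝓘(ℝ, F) 2 G) {ψ : M → M}
    (hψ : ContMDiff (𝓡 2) (𝓡 2) 2 ψ) {c B : ℝ} (hc : 0 < c) (hB : 0 ≤ B)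
    (hlow : ∀ (x : M) (v : TangentSpace (𝓡 2) x), ‖v‖ ≤ c * ‖differential G x v‖)
    (hup : ∀ (x : M) (v : TangentSpace (𝓡 2) x), ‖differential G x v‖ ≤ B * ‖v‖) :
    ∃ δ > 0, ∀ x z : M, edist x z < ENNReal.ofReal δ → ∀ R : ℝ, 1 ≤ R →
      (∀ w, ‖mfderiv (𝓡 2) (𝓡 2) ψ x w‖ ≤ R * ‖w‖) →
        ∀ v, ‖mfderiv (𝓡 2) (𝓡 2) ψ z v‖ ≤ c * (B * c * B + (1 + B * c)) * R * ‖v‖ := by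
  have hG1 := hG.of_le (one_le_two (α := ℕ∞ω))
  have hψ1 := hψ.of_le (one_le_two (α := ℕ∞ω))
  have hGψ : ContMDiff (𝓡 2) 𝓘(ℝ, F) 2 (G ∘ ψ) := hG.comp hψ
  have hGψ1 := hGψ.of_le (one_le_two (α := ℕ∞ω))
  obtain ⟨C, hC, hLip⟩ := exists_differentialLipschitzAt (h := fun x => ((G ∘ ψ) x, G x))
    (hGψ.prodMk_space hG)
  refine ⟨1 / (C + 1), by positivity, fun x z hxz R hR hRx v => ?_⟩
  obtain ⟨b, hb1, hb⟩ := exists_dual_vector'' ℝ (differential (G ∘ ψ) z v)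
  have hb' : b (differential (G ∘ ψ) z v) = ‖differential (G ∘ ψ) z v‖ := hb
  -- `β` transports `b ∘ d(G ∘ ψ)` at `x` to a covector seen through `G`. The pair `(b, -β)` then
  -- kills the differential of `(G ∘ ψ, G)` at `x`, so it is small at `z`, where `β ∘ dG` has a
  -- known bound.
  obtain ⟨β, hβ, hβn⟩ := exists_dual_comp_eq (differential G x).toLinearMap
    (b.toLinearMap ∘ₗ (differential (G ∘ ψ) x).toLinearMap) (R := B * c * R) (by positivity)
    (fun w => by
      change |b (differential (G ∘ ψ) x w)| ≤ B * c * R * ‖differential G x w‖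
      calc |b (differential (G ∘ ψ) x w)| ≤ 1 * ‖differential (G ∘ ψ) x w‖ :=
            (b.le_opNorm _).trans (by gcongr)
        _ ≤ B * (R * (c * ‖differential G x w‖)) := by
            rw [one_mul, differential_comp hG1 hψ1]
            refine (hup _ _).trans (mul_le_mul_of_nonneg_left ((hRx w).trans ?_) hB)
            exact mul_le_mul_of_nonneg_left (hlow x w) (by positivity)
        _ = _ := by ring)
  have hβ' : ∀ w, β (differential G x w) = b (differential (G ∘ ψ) x w) := hβ
  set bb : F × F →L[ℝ] ℝ :=
    b.comp (ContinuousLinearMap.fst ℝ F F) - β.comp (ContinuousLinearMap.snd ℝ F F) with hbb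
  have hbbn : ‖bb‖ ≤ 1 + B * c * R := by
    refine (norm_sub_le _ _).trans (add_le_add ?_ ?_)
    · exact (ContinuousLinearMap.opNorm_comp_le _ _).trans
        (mul_le_one₀ hb1 (norm_nonneg _) (ContinuousLinearMap.norm_fst_le _ _ _))
    · exact (ContinuousLinearMap.opNorm_comp_le _ _).trans
        ((mul_le_of_le_one_right (norm_nonneg _) (ContinuousLinearMap.norm_snd_le _ _ _)).trans hβn)
  have key := hLip x z _ hxz bb (fun w => by
    rw [differential_prodMk hGψ1 hG1]
    simp [hbb, hβ']) v
  rw [differential_prodMk hGψ1 hG1] at key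
  have key' : ‖differential (G ∘ ψ) z v‖ ≤ B * c * R * (B * ‖v‖) + (1 + B * c * R) * ‖v‖ := by
    have h1 : |b (differential (G ∘ ψ) z v) - β (differential G z v)| ≤
        C * ‖bb‖ * (1 / (C + 1)) * ‖v‖ := key
    have h2 : C * ‖bb‖ * (1 / (C + 1)) * ‖v‖ ≤ (1 + B * c * R) * ‖v‖ := by
      gcongr
      calc C * ‖bb‖ * (1 / (C + 1)) = ‖bb‖ * (C / (C + 1)) := by ring
        _ ≤ ‖bb‖ * 1 := by
            gcongr
            rw [div_le_one (by positivity)]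
            linarith
        _ ≤ _ := by linarith
    have h3 : |β (differential G z v)| ≤ B * c * R * (B * ‖v‖) :=
      (β.le_opNorm _).trans (mul_le_mul hβn (hup z v) (norm_nonneg _) (by positivity))
    rw [← hb']
    linarith [le_abs_self (β (differential G z v)),
      le_abs_self (b (differential (G ∘ ψ) z v) - β (differential G z v))]
  refine (hlow _ _).trans ?_
  rw [← differential_comp hG1 hψ1]
  calc c * ‖differential (G ∘ ψ) z v‖
      ≤ c * (B * c * R * (B * ‖v‖) + (1 + B * c * R) * ‖v‖) := by gcongr
    _ ≤ c * (B * c * R * (B * ‖v‖) + (R + B * c * R) * ‖v‖) := by gcongr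
    _ = _ := by ring

end Compact

/-! ### Lipschitz dependence of the stable direction under strong contraction. -/

section Lipschitz

variable {M : Type*} [EMetricSpace M] [CompactSpace M]
  [ChartedSpace (EuclideanSpace ℝ (Fin 2)) M] [IsManifold (𝓡 2) ∞ M]
  [RiemannianBundle (fun x : M => TangentSpace (𝓡 2) x)]
  [IsContinuousRiemannianBundle (EuclideanSpace ℝ (Fin 2)) (fun x : M => TangentSpace (𝓡 2) x)]
  [IsRiemannianManifold (𝓡 2) M]
  {F : Type*} [NormedAddCommGroup F] [NormedSpace ℝ F]

/-- A splitting over `Λ` with angles bounded below (through `K`), the first factor of which is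
contracted by the differential of `ψ` by the factor `σ`, and the second expanded by the
factor `σ⁻¹`. -/
structure IsContractingSplitting (ψ : M → M) (Λ : Set M)
    (Es Eu : (x : M) → Submodule ℝ (TangentSpace (𝓡 2) x)) (K σ : ℝ) : Prop where
  mapsTo : MapsTo ψ Λ Λ
  exists_add : ∀ x ∈ Λ, ∀ v, ∃ a ∈ Es x, ∃ b ∈ Eu x, v = a + b
  norm_le_stable : ∀ x ∈ Λ, ∀ a ∈ Es x, ∀ b ∈ Eu x, ‖a‖ ≤ K * ‖a + b‖
  norm_le_unstable : ∀ x ∈ Λ, ∀ a ∈ Es x, ∀ b ∈ Eu x, ‖b‖ ≤ K * ‖a + b‖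
  finrank_unstable : ∀ x ∈ Λ, Module.finrank ℝ (Eu x) = 1
  map_stable : ∀ x ∈ Λ, (Es x).map (mfderiv (𝓡 2) (𝓡 2) ψ x).toLinearMap = Es (ψ x)
  map_unstable : ∀ x ∈ Λ, (Eu x).map (mfderiv (𝓡 2) (𝓡 2) ψ x).toLinearMap = Eu (ψ x)
  contraction : ∀ x ∈ Λ, ∀ v ∈ Es x, ‖mfderiv (𝓡 2) (𝓡 2) ψ x v‖ ≤ σ * ‖v‖
  expansion : ∀ x ∈ Λ, ∀ v ∈ Eu x, ‖v‖ ≤ σ * ‖mfderiv (𝓡 2) (𝓡 2) ψ x v‖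

variable {ψ : M → M} {Λ : Set M} {Es Eu : (x : M) → Submodule ℝ (TangentSpace (𝓡 2) x)} {K σ : ℝ}

omit [CompactSpace M] [IsManifold (𝓡 2) ∞ M] [IsRiemannianManifold (𝓡 2) M]
  [IsContinuousRiemannianBundle (EuclideanSpace ℝ (Fin 2))
    (fun x : M => TangentSpace (𝓡 2) x)] in
/-- The rate `m` at which the differential of `ψ` expands the unstable line. -/
lemma IsContractingSplitting.exists_rate (h : IsContractingSplitting ψ Λ Es Eu K σ) (hσ : σ ≤ 1)
    {x : M} (hx : x ∈ Λ) :
    ∃ m : ℝ, 1 ≤ m ∧ ∀ v ∈ Eu x, ‖mfderiv (𝓡 2) (𝓡 2) ψ x v‖ = m * ‖v‖ := by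
  obtain ⟨⟨u, hu⟩, hu0, hspan⟩ := finrank_eq_one_iff'.1 (h.finrank_unstable x hx)
  have hu0' : u ≠ 0 := fun h0 => hu0 (Subtype.ext h0)
  have hun : 0 < ‖u‖ := norm_pos_iff.2 hu0'
  refine ⟨‖mfderiv (𝓡 2) (𝓡 2) ψ x u‖ / ‖u‖, ?_, fun v hv => ?_⟩
  · rw [le_div_iff₀ hun, one_mul]
    exact (h.expansion x hx u hu).trans (mul_le_of_le_one_left (norm_nonneg _) hσ)
  · obtain ⟨t, ht⟩ := hspan ⟨v, hv⟩
    have ht' : v = t • u := (congrArg Subtype.val ht).symm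
    rw [ht', map_smul, norm_smul, norm_smul]
    field_simp

omit [CompactSpace M] [IsManifold (𝓡 2) ∞ M] [IsRiemannianManifold (𝓡 2) M]
  [IsContinuousRiemannianBundle (EuclideanSpace ℝ (Fin 2))
    (fun x : M => TangentSpace (𝓡 2) x)] in
-- Neither component is stretched by more than `m`, so the expansion in every direction is
-- controlled by the rate on the unstable line; this allows `m` to cancel later.
lemma IsContractingSplitting.norm_mfderiv_le (h : IsContractingSplitting ψ Λ Es Eu K σ)
    (hσ : σ ≤ 1) {x : M} (hx : x ∈ Λ) {m : ℝ} (hm1 : 1 ≤ m)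
    (hm : ∀ v ∈ Eu x, ‖mfderiv (𝓡 2) (𝓡 2) ψ x v‖ = m * ‖v‖) (w : TangentSpace (𝓡 2) x) :
    ‖mfderiv (𝓡 2) (𝓡 2) ψ x w‖ ≤ 2 * K * m * ‖w‖ := by
  obtain ⟨a, ha, b, hb, rfl⟩ := h.exists_add x hx w
  rw [map_add]
  have e1 := h.norm_le_stable x hx a ha b hb
  have e2 := h.norm_le_unstable x hx a ha b hb
  have e3 := h.contraction x hx a ha
  have e4 := hm b hb
  have hm0 : 0 < m := zero_lt_one.trans_le hm1
  calc _ ≤ ‖mfderiv (𝓡 2) (𝓡 2) ψ x a‖ + ‖mfderiv (𝓡 2) (𝓡 2) ψ x b‖ := norm_add_le _ _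
    _ ≤ m * (K * ‖a + b‖) + m * (K * ‖a + b‖) := by
      refine add_le_add (e3.trans ?_) (e4.trans_le ?_)
      · exact mul_le_mul (hσ.trans hm1) e1 (norm_nonneg _) hm0.le
      · exact mul_le_mul_of_nonneg_left e2 hm0.le
    _ = _ := by ring

omit [CompactSpace M] [IsManifold (𝓡 2) ∞ M] [IsRiemannianManifold (𝓡 2) M]
  [IsContinuousRiemannianBundle (EuclideanSpace ℝ (Fin 2))
    (fun x : M => TangentSpace (𝓡 2) x)] in
/-- A covector vanishing on the stable line at `x` is the pull-back of a covector at `ψ x` which is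
smaller by the expansion rate. -/
lemma IsContractingSplitting.exists_dual_pushforward (h : IsContractingSplitting ψ Λ Es Eu K σ)
    (hψ : ContMDiff (𝓡 2) (𝓡 2) 1 ψ) {G : M → F} (hG : ContMDiff (𝓡 2) 𝓘(ℝ, F) 1 G)
    {c B : ℝ} (hc : 0 < c) (hB : 0 ≤ B) (hK : 1 ≤ K)
    (hlow : ∀ (x : M) (v : TangentSpace (𝓡 2) x), ‖v‖ ≤ c * ‖differential G x v‖)
    (hup : ∀ (x : M) (v : TangentSpace (𝓡 2) x), ‖differential G x v‖ ≤ B * ‖v‖)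
    {x : M} (hx : x ∈ Λ) {m : ℝ} (hm0 : 0 < m)
    (hm : ∀ v ∈ Eu x, ‖mfderiv (𝓡 2) (𝓡 2) ψ x v‖ = m * ‖v‖)
    {β : F →L[ℝ] ℝ} (hβ : ∀ w ∈ Es x, β (differential G x w) = 0) :
    ∃ β' : F →L[ℝ] ℝ, (∀ w, β' (differential (G ∘ ψ) x w) = β (differential G x w)) ∧
      ‖β'‖ ≤ B * K * c / m * ‖β‖ := by
  have hψx := h.mapsTo hx
  refine exists_dual_comp_eq (differential (G ∘ ψ) x).toLinearMap
    (β.toLinearMap ∘ₗ (differential G x).toLinearMap) (by positivity) fun w => ?_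
  change |β (differential G x w)| ≤ B * K * c / m * ‖β‖ * ‖differential (G ∘ ψ) x w‖
  obtain ⟨a, ha, b, hb, rfl⟩ := h.exists_add x hx w
  rw [map_add (differential G x), map_add β, hβ a ha, zero_add]
  have e1 : m * ‖b‖ ≤ K * ‖mfderiv (𝓡 2) (𝓡 2) ψ x (a + b)‖ := by
    rw [← hm b hb, map_add]
    exact h.norm_le_unstable _ hψx _ (h.map_stable x hx ▸ Submodule.mem_map_of_mem ha) _
      (h.map_unstable x hx ▸ Submodule.mem_map_of_mem hb)
  have e2 : ‖mfderiv (𝓡 2) (𝓡 2) ψ x (a + b)‖ ≤ c * ‖differential (G ∘ ψ) x (a + b)‖ := by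
    rw [differential_comp hG hψ]
    exact hlow _ _
  have e3 : m * ‖b‖ ≤ K * (c * ‖differential (G ∘ ψ) x (a + b)‖) :=
    e1.trans (mul_le_mul_of_nonneg_left e2 (by positivity))
  calc |β (differential G x b)| ≤ ‖β‖ * (B * ‖b‖) :=
        (β.le_opNorm _).trans (mul_le_mul_of_nonneg_left (hup x b) (norm_nonneg _))
    _ = ‖β‖ * B / m * (m * ‖b‖) := by field_simp
    _ ≤ ‖β‖ * B / m * (K * (c * ‖differential (G ∘ ψ) x (a + b)‖)) :=
        mul_le_mul_of_nonneg_left e3 (by positivity)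
    _ = _ := by ring

/-- One iteration: the covector gains `κ / m`, the distance `L * (2 * K * m)` and the vector `σ`.
The product is free of `m` and at most `1 / 2`. -/
lemma contraction_step_le {A L K m s e κ σ b v b' v' : ℝ} (hA : 0 ≤ A) (hL : 1 ≤ L) (hK : 1 ≤ K)
    (hm : 1 ≤ m) (hs : 0 ≤ s) (he : 0 ≤ e) (hκ : 0 ≤ κ) (hb : 0 ≤ b) (hv : 0 ≤ v)
    (hb0 : 0 ≤ b') (hv0 : 0 ≤ v') (hσ : κ * σ * (L * (2 * K)) ≤ 1 / 2)
    (hb' : b' ≤ κ / m * b) (hv' : v' ≤ σ * v) :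
    (A * (L * (2 * K * m) * s) + e) * b' * v' ≤ 1 / 2 * (A * s + e) * b * v := by
  have hm0 : 0 < m := zero_lt_one.trans_le hm
  have e1 : 1 ≤ L * (2 * K) := by nlinarith
  have e2 : e ≤ L * (2 * K) * m * e :=
    le_mul_of_one_le_left he (one_le_mul_of_one_le_of_one_le e1 hm)
  calc (A * (L * (2 * K * m) * s) + e) * b' * v'
      ≤ (A * (L * (2 * K * m) * s) + L * (2 * K) * m * e) * (κ / m * b) * (σ * v) := by
        gcongr
    _ = κ * σ * (L * (2 * K)) * ((A * s + e) * b * v) := by field_simp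
    _ ≤ 1 / 2 * ((A * s + e) * b * v) := by gcongr
    _ = _ := by ring

/-- The constant by which the bound of the differential at a point has to be multiplied to become
a bound at the nearby points, in terms of the bounds of an immersion. -/
abbrev nearConst (c B : ℝ) : ℝ := c * (B * c * B + (1 + B * c)) + 1

/-- If the contraction is strong compared with the geometric constants, the stable direction
depends on the point of `Λ` in a Lipschitz way: a covector coming from the ambient space of an
immersion `G` which vanishes on the stable line at `x` is of size `d(x, y)` on the stable line
at `y`. -/
theorem IsContractingSplitting.exists_lipschitz (h : IsContractingSplitting ψ Λ Es Eu K σ)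
    (hψ : ContMDiff (𝓡 2) (𝓡 2) 2 ψ) {G : M → F} (hG : ContMDiff (𝓡 2) 𝓘(ℝ, F) 2 G)
    {c B : ℝ} (hc : 0 < c) (hB : 0 ≤ B) (hK : 1 ≤ K) (hσ1 : σ ≤ 1)
    (hlow : ∀ (x : M) (v : TangentSpace (𝓡 2) x), ‖v‖ ≤ c * ‖differential G x v‖)
    (hup : ∀ (x : M) (v : TangentSpace (𝓡 2) x), ‖differential G x v‖ ≤ B * ‖v‖)
    (hσ : B * K * c * σ * (nearConst c B * (2 * K)) ≤ 1 / 2) :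
    ∃ A, 0 ≤ A ∧ ∀ x ∈ Λ, ∀ y ∈ Λ, ∀ s : ℝ, edist x y < ENNReal.ofReal s → ∀ β : F →L[ℝ] ℝ,
      (∀ w ∈ Es x, β (differential G x w) = 0) →
        ∀ v ∈ Es y, |β (differential G y v)| ≤ A * s * ‖β‖ * ‖v‖ := by
  have hG1 := hG.of_le (one_le_two (α := ℕ∞ω))
  have hψ1 := hψ.of_le (one_le_two (α := ℕ∞ω))
  have hGψ : ContMDiff (𝓡 2) 𝓘(ℝ, F) 2 (G ∘ ψ) := hG.comp hψ
  have hGψ1 := hGψ.of_le (one_le_two (α := ℕ∞ω))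
  obtain ⟨C, hC, hLip⟩ := exists_differentialLipschitzAt (h := fun x => ((G ∘ ψ) x, G x))
    (hGψ.prodMk_space hG)
  obtain ⟨δ, hδ, hnear⟩ := exists_norm_mfderiv_le_near hG hψ hc hB hlow hup
  set L := nearConst c B with hL
  have hL1 : 1 ≤ L := by
    have : 0 ≤ c * (B * c * B + (1 + B * c)) := by positivity
    simp only [hL, nearConst]; linarith
  set κ := B * K * c with hκ
  have hκ0 : 0 ≤ κ := by positivity
  -- The first entry makes the claim trivial when `s ≥ δ`; the second makes the comparison error at
  -- most half of the Lipschitz bound, the other half being the contracted bound at the image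
  -- points.
  set A := max (B / δ) (2 * (C * (κ + 1))) with hA
  have hA0 : 0 ≤ A := le_max_of_le_left (by positivity)
  -- the estimate with an error term that decreases geometrically
  have hn : ∀ n : ℕ, ∀ x ∈ Λ, ∀ y ∈ Λ, ∀ s : ℝ, edist x y < ENNReal.ofReal s →
      ∀ β : F →L[ℝ] ℝ, (∀ w ∈ Es x, β (differential G x w) = 0) →
        ∀ v ∈ Es y, |β (differential G y v)| ≤ (A * s + B * (1 / 2) ^ n) * ‖β‖ * ‖v‖ := by
    intro n
    induction n with
    | zero =>
      intro x _ y _ s hs β _ v _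
      have hs0 := pos_of_edist_lt_ofReal hs
      calc |β (differential G y v)| ≤ ‖β‖ * (B * ‖v‖) :=
            (β.le_opNorm _).trans (mul_le_mul_of_nonneg_left (hup y v) (norm_nonneg _))
        _ = (0 + B * (1 / 2) ^ 0) * ‖β‖ * ‖v‖ := by ring
        _ ≤ _ := by gcongr; positivity
    | succ n ih =>
      intro x hx y hy s hs β hβ v hv
      have hs0 := pos_of_edist_lt_ofReal hs
      rcases le_or_gt δ s with hδs | hsδ
      · calc |β (differential G y v)| ≤ ‖β‖ * (B * ‖v‖) :=
              (β.le_opNorm _).trans (mul_le_mul_of_nonneg_left (hup y v) (norm_nonneg _))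
          _ = (B / δ * δ + 0) * ‖β‖ * ‖v‖ := by field_simp; ring
          _ ≤ _ := by
            gcongr
            · exact le_max_left _ _
            · positivity
      obtain ⟨m, hm1, hm⟩ := h.exists_rate hσ1 hx
      have hm0 : 0 < m := zero_lt_one.trans_le hm1
      have hψx := h.mapsTo hx
      -- the covector at `ψ x` corresponding to `β`
      obtain ⟨β', hβ'', hβn⟩ :=
        h.exists_dual_pushforward hψ1 hG1 hc hB hK hlow hup hx hm0 hm hβ
      have hκm : κ / m ≤ κ := div_le_self hκ0 hm1
      -- comparison of the two covectors at `y`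
      set bb : F × F →L[ℝ] ℝ :=
        β'.comp (ContinuousLinearMap.fst ℝ F F) - β.comp (ContinuousLinearMap.snd ℝ F F) with hbb
      have hbbn : ‖bb‖ ≤ (κ + 1) * ‖β‖ := by
        have e1 : ‖β'.comp (ContinuousLinearMap.fst ℝ F F)‖ ≤ κ * ‖β‖ :=
          (ContinuousLinearMap.opNorm_comp_le _ _).trans
            ((mul_le_of_le_one_right (norm_nonneg _)
              (ContinuousLinearMap.norm_fst_le _ _ _)).trans (hβn.trans (by gcongr)))
        have e2 : ‖β.comp (ContinuousLinearMap.snd ℝ F F)‖ ≤ ‖β‖ :=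
          (ContinuousLinearMap.opNorm_comp_le _ _).trans
            (mul_le_of_le_one_right (norm_nonneg _) (ContinuousLinearMap.norm_snd_le _ _ _))
        linarith [norm_sub_le (β'.comp (ContinuousLinearMap.fst ℝ F F))
          (β.comp (ContinuousLinearMap.snd ℝ F F))]
      -- `bb` kills the differential of `(G ∘ ψ, G)` at `x`.
      have key := hLip x y s hs bb (fun w => by
        rw [differential_prodMk hGψ1 hG1]
        simp [hbb, hβ'']) v
      rw [differential_prodMk hGψ1 hG1] at key
      have key1 : |β' (differential (G ∘ ψ) y v) - β (differential G y v)| ≤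
          C * ((κ + 1) * ‖β‖) * s * ‖v‖ :=
        le_trans key (by gcongr)
      -- distance of the images
      have hDx := h.norm_mfderiv_le hσ1 hx hm1 hm
      have hR : 1 ≤ 2 * K * m := by nlinarith
      have hdist : edist (ψ x) (ψ y) < ENNReal.ofReal (L * (2 * K * m) * s) := by
        have := edist_map_lt_of_enorm_mfderiv_le (I := 𝓡 2) (I' := 𝓡 2) isOpen_univ
          hψ1.contMDiffOn (x := x) (y := y) (s := s.toNNReal) (K := (L * (2 * K * m)).toNNReal)
          (by rw [Real.toNNReal_pos]; positivity) (fun _ _ => mem_univ _)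
          (fun z hz w => ?_) hs
        · rwa [← ENNReal.coe_mul, ← Real.toNNReal_mul (by positivity)] at this
        · have h1 := hnear x z (lt_trans hz ((ENNReal.ofReal_lt_ofReal_iff hδ).2 hsδ)) _ hR hDx w
          rw [← ofReal_norm, ← ofReal_norm]
          change _ ≤ ENNReal.ofReal (L * (2 * K * m)) * _
          rw [← ENNReal.ofReal_mul (by positivity)]
          refine ENNReal.ofReal_le_ofReal (h1.trans ?_)
          gcongr
          simp [hL, nearConst]
      -- the estimate at the image points
      have hker : ∀ w ∈ Es (ψ x), β' (differential G (ψ x) w) = 0 := by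
        intro w hw
        rw [← h.map_stable x hx] at hw
        obtain ⟨w, hw, rfl⟩ := hw
        have e := hβ'' w
        rw [differential_comp hG1 hψ1, hβ w hw] at e
        exact e
      have hDv : mfderiv (𝓡 2) (𝓡 2) ψ y v ∈ Es (ψ y) :=
        h.map_stable y hy ▸ Submodule.mem_map_of_mem hv
      have key2 := ih (ψ x) hψx (ψ y) (h.mapsTo hy) _ hdist β' hker _ hDv
      rw [← differential_comp hG1 hψ1] at key2
      have key3 := contraction_step_le hA0 hL1 hK hm1 hs0.le
        (show 0 ≤ B * (1 / 2 : ℝ) ^ n by positivity) hκ0 (norm_nonneg β) (norm_nonneg v)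
        (norm_nonneg β') (norm_nonneg (mfderiv (𝓡 2) (𝓡 2) ψ y v)) hσ hβn (h.contraction y hy v hv)
      have hA2 : C * (κ + 1) ≤ A / 2 := by
        have := le_max_right (B / δ) (2 * (C * (κ + 1)))
        rw [← hA] at this
        linarith
      have key4 : C * ((κ + 1) * ‖β‖) * s * ‖v‖ ≤ A / 2 * (s * ‖β‖ * ‖v‖) := by
        calc C * ((κ + 1) * ‖β‖) * s * ‖v‖ = C * (κ + 1) * (s * ‖β‖ * ‖v‖) := by ring
          _ ≤ _ := by gcongr
      have tri : |β (differential G y v)| ≤ |β' (differential (G ∘ ψ) y v)| +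
          |β' (differential (G ∘ ψ) y v) - β (differential G y v)| := by
        rw [abs_sub_comm]
        linarith [abs_sub_abs_le_abs_sub (β (differential G y v))
          (β' (differential (G ∘ ψ) y v))]
      rw [pow_succ]
      calc |β (differential G y v)|
          ≤ 1 / 2 * (A * s + B * (1 / 2) ^ n) * ‖β‖ * ‖v‖ + A / 2 * (s * ‖β‖ * ‖v‖) :=
            tri.trans (add_le_add (key2.trans key3) (key1.trans key4))
        _ = (A * s + B * ((1 / 2) ^ n * (1 / 2))) * ‖β‖ * ‖v‖ := by ring
  refine ⟨A, hA0, fun x hx y hy s hs β hβ v hv => ?_⟩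
  have hlim : Tendsto (fun n : ℕ => (A * s + B * (1 / 2 : ℝ) ^ n) * ‖β‖ * ‖v‖) atTop
      (𝓝 ((A * s + B * 0) * ‖β‖ * ‖v‖)) :=
    (((tendsto_pow_atTop_nhds_zero_of_lt_one (by norm_num) (by norm_num)).const_mul B).const_add
      (A * s)).mul_const _ |>.mul_const _
  simpa using ge_of_tendsto' hlim fun n => hn n x hx y hy s hs β hβ v hv

end Lipschitz

/-! ### Iterates and inverses. -/

section Iterates

variable {M : Type*} [EMetricSpace M] [ChartedSpace (EuclideanSpace ℝ (Fin 2)) M]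
  {φ : M ≃ₘ^2⟮𝓡 2, 𝓡 2⟯ M} {Λ : Set M} {Es Eu : (x : M) → Submodule ℝ (TangentSpace (𝓡 2) x)}

lemma map_mfderiv_iterate {ψ : M → M} (hψ : ContMDiff (𝓡 2) (𝓡 2) 1 ψ) (hΛ : MapsTo ψ Λ Λ)
    (h : ∀ x ∈ Λ, (Es x).map (mfderiv (𝓡 2) (𝓡 2) ψ x).toLinearMap = Es (ψ x)) (k : ℕ) :
    ∀ x ∈ Λ, (Es x).map (mfderiv (𝓡 2) (𝓡 2) (ψ^[k]) x).toLinearMap = Es (ψ^[k] x) := by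
  intro x hx
  induction k with
  | zero =>
    have : mfderiv (𝓡 2) (𝓡 2) (ψ^[0]) x = ContinuousLinearMap.id ℝ (TangentSpace (𝓡 2) x) :=
      mfderiv_id
    rw [this]
    exact Submodule.map_id _
  | succ k ih =>
    have h1 : mfderiv (𝓡 2) (𝓡 2) (ψ ∘ ψ^[k]) x = _ :=
      mfderiv_comp x (hψ.mdifferentiableAt one_ne_zero)
        ((hψ.iterate k).mdifferentiableAt one_ne_zero)
    rw [Function.iterate_succ', h1]
    refine (Submodule.map_comp _ _ _).trans ?_
    rw [ih]
    exact h _ (hΛ.iterate k hx)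

/-- The equality is stated in the model space because the two sides live in tangent spaces whose
base points are only propositionally equal. -/
lemma mfderiv_symm_iterate_apply (φ : M ≃ₘ^2⟮𝓡 2, 𝓡 2⟯ M) (n : ℕ) (x : M)
    (v : TangentSpace (𝓡 2) x) :
    (mfderiv (𝓡 2) (𝓡 2) (φ.symm^[n]) (φ^[n] x) (mfderiv (𝓡 2) (𝓡 2) (φ^[n]) x v) :
      EuclideanSpace ℝ (Fin 2)) = v := by
  have h1 := (φ.contMDiff.of_le one_le_two).iterate n
  have h2 := (φ.symm.contMDiff.of_le one_le_two).iterate n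
  have h3 : (φ.symm^[n]) ∘ (φ^[n]) = id := by
    funext y
    exact (Function.LeftInverse.iterate φ.left_inv n) y
  have h4 : mfderiv (𝓡 2) (𝓡 2) ((φ.symm^[n]) ∘ (φ^[n])) x = _ :=
    mfderiv_comp x (h2.mdifferentiableAt one_ne_zero) (h1.mdifferentiableAt one_ne_zero)
  rw [h3, mfderiv_id] at h4
  exact congr($h4 v).symm

variable [RiemannianBundle (fun x : M => TangentSpace (𝓡 2) x)]

lemma norm_mfderiv_symm_iterate_apply (φ : M ≃ₘ^2⟮𝓡 2, 𝓡 2⟯ M) (n : ℕ) (x : M)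
    (v : TangentSpace (𝓡 2) x) :
    ‖mfderiv (𝓡 2) (𝓡 2) (φ.symm^[n]) (φ^[n] x) (mfderiv (𝓡 2) (𝓡 2) (φ^[n]) x v)‖ = ‖v‖ := by
  -- The norm depends on the base point, so the base point is generalised before substituting.
  have key : ∀ (y : M), y = x → ∀ w : EuclideanSpace ℝ (Fin 2), w = (v : EuclideanSpace ℝ (Fin 2)) →
      ‖(show TangentSpace (𝓡 2) y from w)‖ = ‖v‖ := by
    rintro _ rfl _ rfl
    rfl
  exact key _ (Function.LeftInverse.iterate φ.left_inv n x) _ (mfderiv_symm_iterate_apply φ n x v)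

/-- Transfers every result on stable lines to unstable lines. -/
lemma IsSaddleSplitting.symm (h : IsSaddleSplitting φ Λ Es Eu) (hΛ : φ '' Λ = Λ) :
    IsSaddleSplitting φ.symm Λ Eu Es := by
  have hmem : ∀ x ∈ Λ, φ.symm x ∈ Λ := by
    intro x hx
    rw [← hΛ] at hx
    obtain ⟨y, hy, rfl⟩ := hx
    simpa using hy
  have hmap : ∀ V : (x : M) → Submodule ℝ (TangentSpace (𝓡 2) x),
      (∀ x ∈ Λ, (V x).map (mfderiv (𝓡 2) (𝓡 2) φ x).toLinearMap = V (φ x)) →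
      ∀ x ∈ Λ, (V x).map (mfderiv (𝓡 2) (𝓡 2) φ.symm x).toLinearMap = V (φ.symm x) := by
    intro V hV x hx
    rw [← hΛ] at hx
    obtain ⟨y, hy, rfl⟩ := hx
    rw [← hV y hy]
    have e : ∀ w, (mfderiv (𝓡 2) (𝓡 2) φ.symm (φ y) (mfderiv (𝓡 2) (𝓡 2) φ y w) :
      EuclideanSpace ℝ (Fin 2)) = w := mfderiv_symm_iterate_apply φ 1 y
    have key : ∀ z, z = y → ∀ v : EuclideanSpace ℝ (Fin 2),
      ((show TangentSpace (𝓡 2) y from v) ∈ V y ↔ (show TangentSpace (𝓡 2) z from v) ∈ V z) := by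
      rintro _ rfl _
      rfl
    have hz : φ.symm (φ y) = y := φ.left_inv y
    ext v
    refine Iff.trans ?_ (key _ hz v)
    constructor
    · rintro ⟨_, ⟨w, hw, rfl⟩, rfl⟩
      exact (congrArg (fun u : EuclideanSpace ℝ (Fin 2) =>
        (show TangentSpace (𝓡 2) y from u) ∈ V y) (e w)).mpr hw
    · intro hv
      exact ⟨_, ⟨v, hv, rfl⟩, e v⟩
  refine ⟨fun x hx => (h.isCompl x hx).symm, h.finrank_unstable, h.finrank_stable,
    hmap _ h.map_unstable, hmap _ h.map_stable, ?_⟩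
  obtain ⟨C, lam, hC, h0, h1, hcon⟩ := h.contraction
  exact ⟨C, lam, hC, h0, h1, fun x hx n => ⟨(hcon x hx n).2, (hcon x hx n).1⟩⟩

end Iterates

/-! ### Strong contraction by high iterates. -/

section Compact

variable {M : Type*} [EMetricSpace M] [CompactSpace M]
  [ChartedSpace (EuclideanSpace ℝ (Fin 2)) M] [IsManifold (𝓡 2) ∞ M]
  [RiemannianBundle (fun x : M => TangentSpace (𝓡 2) x)]
  [IsContinuousRiemannianBundle (EuclideanSpace ℝ (Fin 2)) (fun x : M => TangentSpace (𝓡 2) x)]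

/-- An embedding in Euclidean space reduces this to bounds for vector valued maps. -/
lemma exists_norm_mfderiv_le {ψ : M → M} (hψ : ContMDiff (𝓡 2) (𝓡 2) 1 ψ) :
    ∃ B, 0 ≤ B ∧ ∀ (x : M) (v : TangentSpace (𝓡 2) x),
      ‖mfderiv (𝓡 2) (𝓡 2) ψ x v‖ ≤ B * ‖v‖ := by
  obtain ⟨n, e, he, -, hinj⟩ := exists_embedding_euclidean_of_compact (I := 𝓡 2) (M := M)
  have he1 : ContMDiff (𝓡 2) 𝓘(ℝ, EuclideanSpace ℝ (Fin n)) 1 e := he.of_le (by simp)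
  obtain ⟨c, hc, hlow⟩ := exists_norm_le_norm_differential he1 hinj
  obtain ⟨B, hB, hup⟩ := exists_norm_differential_le (he1.comp hψ)
  refine ⟨c * B, by positivity, fun x v => (hlow _ _).trans ?_⟩
  rw [← differential_comp he1 hψ, mul_assoc]
  exact mul_le_mul_of_nonneg_left (hup x v) hc.le

variable {φ : M ≃ₘ^2⟮𝓡 2, 𝓡 2⟯ M} {Λ : Set M} {Es Eu : (x : M) → Submodule ℝ (TangentSpace (𝓡 2) x)}

/-- The high iterates of `φ` contract and expand the factors of a saddle splitting as strongly as
wanted, with the same bound on the angles. -/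
lemma IsSaddleSplitting.exists_isContractingSplitting (h : IsSaddleSplitting φ Λ Es Eu)
    (hΛ : φ '' Λ = Λ) : ∃ K, 1 ≤ K ∧ ∀ ε > 0, ∃ (N : ℕ) (σ : ℝ), 0 < σ ∧ σ ≤ ε ∧
      IsContractingSplitting (φ^[N]) Λ Es Eu K σ := by
  obtain ⟨C, lam, hC, h0, h1, hcon⟩ := h.contraction
  have hmaps : MapsTo φ Λ Λ := fun x hx => hΛ ▸ mem_image_of_mem φ hx
  have hφ1 : ContMDiff (𝓡 2) (𝓡 2) 1 φ := φ.contMDiff.of_le one_le_two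
  have hsmall : ∀ ε > 0, ∃ N : ℕ, C * lam ^ N ≤ ε := by
    intro ε hε
    obtain ⟨N, hN⟩ := exists_pow_lt_of_lt_one (div_pos hε hC) h1
    refine ⟨N, ?_⟩
    rw [lt_div_iff₀ hC, mul_comm] at hN
    exact hN.le
  have hexp : ∀ N : ℕ, ∀ x ∈ Λ, ∀ v ∈ Eu x,
      ‖v‖ ≤ C * lam ^ N * ‖mfderiv (𝓡 2) (𝓡 2) (φ^[N]) x v‖ := by
    intro N x hx v hv
    rw [← norm_mfderiv_symm_iterate_apply φ N x v]
    exact (hcon _ (hmaps.iterate N hx) N).2 _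
      (map_mfderiv_iterate hφ1 hmaps h.map_unstable N x hx ▸ Submodule.mem_map_of_mem hv)
  obtain ⟨n, hn⟩ := hsmall (1 / 2) (by norm_num)
  obtain ⟨B, hB, hBd⟩ := exists_norm_mfderiv_le (hφ1.iterate n)
  -- Under `Dφⁿ`, `b` at least doubles and `a` at least halves, while `a + b` grows by at most `B`;
  -- so `a` and `b` cannot nearly cancel. No continuity of the splitting enters.
  have hangle : ∀ x ∈ Λ, ∀ a ∈ Es x, ∀ b ∈ Eu x, ‖b‖ ≤ (B + 1) * ‖a + b‖ := by
    intro x hx a ha b hb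
    have e1 : ‖mfderiv (𝓡 2) (𝓡 2) (φ^[n]) x a‖ ≤ 1 / 2 * ‖a‖ :=
      ((hcon x hx n).1 a ha).trans (by gcongr)
    have e2 : ‖b‖ ≤ 1 / 2 * ‖mfderiv (𝓡 2) (𝓡 2) (φ^[n]) x b‖ :=
      (hexp n x hx b hb).trans (by gcongr)
    have e3 := hBd x (a + b)
    rw [map_add] at e3
    have e4 := norm_sub_le_norm_add (mfderiv (𝓡 2) (𝓡 2) (φ^[n]) x b)
      (mfderiv (𝓡 2) (𝓡 2) (φ^[n]) x a)
    rw [add_comm (mfderiv (𝓡 2) (𝓡 2) (φ^[n]) x b)] at e4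
    have e5 : ‖a‖ ≤ ‖a + b‖ + ‖b‖ := by
      simpa using norm_sub_le (a + b) b
    linarith [mul_nonneg hB (norm_nonneg (a + b)), norm_nonneg (a + b)]
  refine ⟨B + 2, by linarith, fun ε hε => ?_⟩
  obtain ⟨N, hN⟩ := hsmall ε hε
  refine ⟨N, C * lam ^ N, by positivity, hN, hmaps.iterate N, ?_, ?_, ?_, h.finrank_unstable,
    map_mfderiv_iterate hφ1 hmaps h.map_stable N, map_mfderiv_iterate hφ1 hmaps h.map_unstable N,
    fun x hx v hv => (hcon x hx N).1 v hv, hexp N⟩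
  · intro x hx v
    have : v ∈ Es x ⊔ Eu x := by rw [(h.isCompl x hx).sup_eq_top]; trivial
    obtain ⟨a, ha, b, hb, hab⟩ := Submodule.mem_sup.1 this
    exact ⟨a, ha, b, hb, hab.symm⟩
  · intro x hx a ha b hb
    have e1 := hangle x hx a ha b hb
    have e5 : ‖a‖ ≤ ‖a + b‖ + ‖b‖ := by
      simpa using norm_sub_le (a + b) b
    linarith
  · intro x hx a ha b hb
    have e1 := hangle x hx a ha b hb
    linarith [norm_nonneg (a + b)]

variable [IsRiemannianManifold (𝓡 2) M] {F : Type*} [NormedAddCommGroup F] [NormedSpace ℝ F]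

/-- The stable direction of a saddle splitting of a `C²` surface diffeomorphism depends on the
point in a Lipschitz way: a covector coming from the ambient space of an immersion `G` which
vanishes on the stable line at `x` is of size `d(x, y)` on the stable line at `y`. -/
theorem IsSaddleSplitting.exists_lipschitz (h : IsSaddleSplitting φ Λ Es Eu)
    (hΛ : φ '' Λ = Λ) {G : M → F} (hG : ContMDiff (𝓡 2) 𝓘(ℝ, F) 2 G)
    (hinj : ∀ x, Function.Injective (differential G x)) :
    ∃ A, 0 ≤ A ∧ ∀ x ∈ Λ, ∀ y ∈ Λ, ∀ s : ℝ, edist x y < ENNReal.ofReal s → ∀ β : F →L[ℝ] ℝ,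
      (∀ w ∈ Es x, β (differential G x w) = 0) →
        ∀ v ∈ Es y, |β (differential G y v)| ≤ A * s * ‖β‖ * ‖v‖ := by
  have hG1 := hG.of_le (one_le_two (α := ℕ∞ω))
  obtain ⟨c, hc, hlow⟩ := exists_norm_le_norm_differential hG1 hinj
  obtain ⟨B, hB, hup⟩ := exists_norm_differential_le hG1
  obtain ⟨K, hK, hsplit⟩ := h.exists_isContractingSplitting hΛ
  have hQ : 0 ≤ B * K * c * (nearConst c B * (2 * K)) := by
    have : 0 ≤ nearConst c B := by unfold nearConst; positivity
    positivity
  -- `K`, `c` and `B` do not depend on the iterate, so `σ` can be chosen small after them.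
  obtain ⟨N, σ, hσ0, hσ, hN⟩ :=
    hsplit (min 1 (1 / (2 * (B * K * c * (nearConst c B * (2 * K)) + 1)))) (by positivity)
  refine hN.exists_lipschitz (φ.contMDiff.iterate N) hG hc hB hK (hσ.trans (min_le_left _ _))
    hlow hup ?_
  have h2 := hσ.trans (min_le_right _ _)
  rw [le_div_iff₀ (by positivity)] at h2
  nlinarith

end Compact

/-! ### The `C^r` topology. -/

section CrTopology

variable {M : Type*} [EMetricSpace M] [ChartedSpace (EuclideanSpace ℝ (Fin 2)) M]
  {r : ℕ∞}

lemma contDiffOn_comp_symm {f : M → ℝ} (hf : ContMDiff (𝓡 2) 𝓘(ℝ, ℝ) r f)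
    {e : OpenPartialHomeomorph M (EuclideanSpace ℝ (Fin 2))}
    (he : e ∈ IsManifold.maximalAtlas (𝓡 2) ∞ M) : ContDiffOn ℝ r (f ∘ e.symm) e.target := by
  rw [← contMDiffOn_iff_contDiffOn]
  exact hf.comp_contMDiffOn
    ((contMDiffOn_symm_of_mem_maximalAtlas he).of_le (by exact_mod_cast le_top))

/-- Lines are continuous for the `C^r` topology. -/
lemma continuous_sub_smul_crTopology (f g : C^r⟮𝓡 2, M; 𝓘(ℝ, ℝ), ℝ⟯) :
    @Continuous ℝ _ _ (crTopology M r) fun t : ℝ => f - t • g := by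
  refine continuous_iInf_rng.2 fun e => continuous_iInf_rng.2 fun he => continuous_iInf_rng.2
    fun k => continuous_iInf_rng.2 fun hk => continuous_induced_rng.2 ?_
  have hf := contDiffOn_comp_symm f.contMDiff he
  have hg := contDiffOn_comp_symm g.contMDiff he
  have hk' : (k : ℕ∞ω) ≤ r := by exact_mod_cast hk
  have huniq := e.open_target.uniqueDiffOn (𝕜 := ℝ)
  rw [continuous_iff_continuousAt]
  intro t₀
  refine (UniformOnFun.tendsto_iff_tendstoUniformlyOn (𝔖 := {K | IsCompact K ∧ K ⊆ e.target})).2 ?_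
  rintro K ⟨hK, hKe⟩
  have hform : ∀ t : ℝ, ∀ x ∈ K,
      iteratedFDerivWithin ℝ k ((f - t • g : C^r⟮𝓡 2, M; 𝓘(ℝ, ℝ), ℝ⟯) ∘ e.symm) e.target x =
        iteratedFDerivWithin ℝ k (f ∘ e.symm) e.target x -
          t • iteratedFDerivWithin ℝ k (g ∘ e.symm) e.target x := by
    intro t x hx
    have hfx := (hf x (hKe hx)).of_le hk'
    have hgx := (hg x (hKe hx)).of_le hk'
    have h1 : (f - t • g : C^r⟮𝓡 2, M; 𝓘(ℝ, ℝ), ℝ⟯) ∘ e.symm =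
      (f ∘ e.symm) - t • (g ∘ e.symm) := rfl
    rw [h1, iteratedFDerivWithin_sub_apply hfx (show ContDiffWithinAt ℝ k (t • (g ∘ e.symm)) _ _ from
        hgx.const_smul t) huniq (hKe hx),
      iteratedFDerivWithin_const_smul_apply hgx huniq (hKe hx)]
  -- On `K` the derivatives for two parameters differ by the parameter difference times a derivative
  -- of `g`, which is bounded there.
  obtain ⟨C, hC⟩ := hK.exists_bound_of_continuousOn
    ((hg.continuousOn_iteratedFDerivWithin hk' huniq).mono hKe)
  rw [Metric.tendstoUniformlyOn_iff]
  intro ε hε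
  have hC1 : 0 < |C| + 1 := by positivity
  filter_upwards [Metric.ball_mem_nhds t₀ (div_pos hε hC1)] with t ht x hx
  change dist (iteratedFDerivWithin ℝ k ((f - t₀ • g : C^r⟮𝓡 2, M; 𝓘(ℝ, ℝ), ℝ⟯) ∘ e.symm) e.target x)
    (iteratedFDerivWithin ℝ k ((f - t • g : C^r⟮𝓡 2, M; 𝓘(ℝ, ℝ), ℝ⟯) ∘ e.symm) e.target x) < ε
  rw [hform t₀ x hx, hform t x hx, dist_eq_norm, sub_sub_sub_cancel_left, ← sub_smul, norm_smul]
  have h2 : ‖t - t₀‖ < ε / (|C| + 1) := by simpa [dist_eq_norm] using ht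
  rw [lt_div_iff₀ hC1] at h2
  refine lt_of_le_of_lt (mul_le_mul_of_nonneg_left ?_ (norm_nonneg _)) h2
  linarith [hC x hx, le_abs_self C]

variable [IsManifold (𝓡 2) ∞ M] [RiemannianBundle (fun x : M => TangentSpace (𝓡 2) x)]
  [IsContinuousRiemannianBundle (EuclideanSpace ℝ (Fin 2)) (fun x : M => TangentSpace (𝓡 2) x)]

/-- For the `C^r` topology with `r ≥ 1`, nearby functions have uniformly close differentials on a
compact manifold. -/
lemma setOf_differential_sub_le_mem_nhds [CompactSpace M] (hr : 1 ≤ r)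
    (f : C^r⟮𝓡 2, M; 𝓘(ℝ, ℝ), ℝ⟯) {ε : ℝ} (hε : 0 < ε) :
    {g : C^r⟮𝓡 2, M; 𝓘(ℝ, ℝ), ℝ⟯ | ∀ (x : M) (v : TangentSpace (𝓡 2) x),
      |differential g x v - differential f x v| ≤ ε * ‖v‖} ∈ @nhds _ (crTopology M r) f := by
  let := crTopology M r
  have hr' : (1 : ℕ∞ω) ≤ r := by exact_mod_cast hr
  suffices {g : C^r⟮𝓡 2, M; 𝓘(ℝ, ℝ), ℝ⟯ | ∀ x ∈ (univ : Set M), ∀ v : TangentSpace (𝓡 2) x,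
      |differential g x v - differential f x v| ≤ ε * ‖v‖} ∈ 𝓝 f by simpa using this
  refine isCompact_univ.induction_on (p := fun s : Set M =>
    {g : C^r⟮𝓡 2, M; 𝓘(ℝ, ℝ), ℝ⟯ | ∀ x ∈ s, ∀ v : TangentSpace (𝓡 2) x,
      |differential g x v - differential f x v| ≤ ε * ‖v‖} ∈ 𝓝 f) (by simp) ?_ ?_ ?_
  · intro s t hst ht
    exact mem_of_superset ht fun g hg x hx => hg x (hst hx)
  · intro s t hs ht
    filter_upwards [hs, ht] with g h1 h2 x hx
    exact hx.elim (h1 x) (h2 x)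
  intro p _
  obtain ⟨C, hC, hCb⟩ := eventually_norm_differential_extChartAt_le p
  set e := chartAt (EuclideanSpace ℝ (Fin 2)) p
  obtain ⟨K, hK, hKe, hKc⟩ := local_compact_nhds
    (e.open_target.mem_nhds (e.map_source (mem_chart_source _ p)))
  have hKp : e ⁻¹' K ∈ 𝓝 p := (e.continuousAt (mem_chart_source _ p)).preimage_mem_nhds hK
  refine ⟨_, mem_nhdsWithin_of_mem_nhds
    (inter_mem (inter_mem hKp (extChartAt_source_mem_nhds (I := 𝓡 2) p)) hCb), ?_⟩
  have he : e ∈ IsManifold.maximalAtlas (𝓡 2) ∞ M := IsManifold.chart_mem_maximalAtlas p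
  -- Only the first-order component in the chart at `p` is needed.
  have hΦ : Continuous fun g : C^r⟮𝓡 2, M; 𝓘(ℝ, ℝ), ℝ⟯ =>
      UniformOnFun.ofFun {K : Set (EuclideanSpace ℝ (Fin 2)) | IsCompact K ∧ K ⊆ e.target}
        (iteratedFDerivWithin ℝ 1 (g ∘ e.symm) e.target) :=
    continuous_iff_le_induced.2 (iInf_le_of_le e <| iInf_le_of_le he <| iInf_le_of_le 1 <|
      iInf_le_of_le (by exact_mod_cast hr) le_rfl)
  filter_upwards [hΦ.continuousAt.preimage_mem_nhds (UniformOnFun.gen_mem_nhds _ _ _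
    (show K ∈ {K : Set (EuclideanSpace ℝ (Fin 2)) | IsCompact K ∧ K ⊆ e.target} from ⟨hKc, hKe⟩)
    (Metric.dist_mem_uniformity (div_pos hε hC)))] with g hg
  rintro x ⟨⟨hxK, hxs⟩, hxC⟩ v
  have hgx : dist (iteratedFDerivWithin ℝ 1 (f ∘ e.symm) e.target (e x))
    (iteratedFDerivWithin ℝ 1 (g ∘ e.symm) e.target (e x)) < ε / C := hg (e x) hxK
  have hrep : ∀ h : C^r⟮𝓡 2, M; 𝓘(ℝ, ℝ), ℝ⟯, differential h x v =
      iteratedFDerivWithin ℝ 1 (h ∘ e.symm) e.target (e x)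
        (fun _ => differential (extChartAt (𝓡 2) p) x v) := by
    intro h
    rw [differential_eq_fderiv_comp (h.contMDiff.of_le hr') p hxs,
      iteratedFDerivWithin_one_apply (e.open_target.uniqueDiffOn _ (hKe hxK)),
      fderivWithin_of_isOpen e.open_target (hKe hxK)]
    rfl
  rw [hrep g, hrep f, ← sub_apply, ← Real.norm_eq_abs]
  rw [dist_comm, dist_eq_norm] at hgx
  calc _ ≤ ‖iteratedFDerivWithin ℝ 1 (g ∘ e.symm) e.target (e x) -
        iteratedFDerivWithin ℝ 1 (f ∘ e.symm) e.target (e x)‖ *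
          ∏ _i : Fin 1, ‖differential (extChartAt (𝓡 2) p) x v‖ :=
        ContinuousMultilinearMap.le_opNorm _ _
    _ ≤ ε / C * (C * ‖v‖) := by
        rw [Fin.prod_const, pow_one]
        exact mul_le_mul hgx.le (hxC v) (norm_nonneg _) (by positivity)
    _ = ε * ‖v‖ := by field_simp

end CrTopology

/-- A real bound `s` replaces the distance, which may be infinite. The slack in `A + 1` handles the
strict inequality: a violation would allow `s = |t x - t y| / (A + 1)`. -/
lemma lipschitzOnWith_of_forall_edist_lt {X : Type*} [PseudoEMetricSpace X] {S : Set X}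
    {t : X → ℝ} {A : ℝ} (hA : 0 ≤ A)
    (h : ∀ x ∈ S, ∀ y ∈ S, ∀ s : ℝ, edist x y < ENNReal.ofReal s → |t x - t y| ≤ A * s) :
    LipschitzOnWith (A + 1).toNNReal t S := by
  intro x hx y hy
  by_contra hlt
  rw [not_le] at hlt
  have hA1 : 0 < A + 1 := by positivity
  have hA1' : ENNReal.ofReal (A + 1) ≠ 0 := by simpa using hA1
  have hlt' : edist x y < ENNReal.ofReal (|t x - t y| / (A + 1)) := by
    rw [ENNReal.ofReal_div_of_pos hA1, ENNReal.lt_div_iff_mul_lt (Or.inl hA1') (Or.inl ENNReal.ofReal_ne_top),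
      mul_comm, ← Real.dist_eq, ← edist_dist]
    exact hlt
  have hpos := pos_of_edist_lt_ofReal hlt'
  have := h x hx y hy _ hlt'
  have h2 : |t x - t y| = (A + 1) * (|t x - t y| / (A + 1)) := by field_simp
  rw [h2] at this
  rw [mul_div_cancel₀ _ hA1.ne'] at this
  nlinarith

/-! ### Openness and density of transversality. -/

section Transversality

variable {M : Type*} [EMetricSpace M] [CompactSpace M]
  [ChartedSpace (EuclideanSpace ℝ (Fin 2)) M] [IsManifold (𝓡 2) ∞ M]
  [RiemannianBundle (fun x : M => TangentSpace (𝓡 2) x)]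
  [IsContinuousRiemannianBundle (EuclideanSpace ℝ (Fin 2)) (fun x : M => TangentSpace (𝓡 2) x)]
  [IsRiemannianManifold (𝓡 2) M]
  {φ : M ≃ₘ^2⟮𝓡 2, 𝓡 2⟯ M} {Λ : Set M} {Es Eu : (x : M) → Submodule ℝ (TangentSpace (𝓡 2) x)}
  {r : ℕ∞}

/-- The `C^r` functions whose differential does not vanish on the subspaces `V x`, `x ∈ Λ`. -/
def transversalFunctions (r : ℕ∞) (Λ : Set M) (V : (x : M) → Submodule ℝ (TangentSpace (𝓡 2) x)) :
    Set C^r⟮𝓡 2, M; 𝓘(ℝ, ℝ), ℝ⟯ :=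
  {f | ∀ x ∈ Λ, ∃ v ∈ V x, differential f x v ≠ 0}

omit [CompactSpace M] [IsManifold (𝓡 2) ∞ M] [IsRiemannianManifold (𝓡 2) M]
  [IsContinuousRiemannianBundle (EuclideanSpace ℝ (Fin 2))
    (fun x : M => TangentSpace (𝓡 2) x)] in
lemma IsSaddleSplitting.exists_stable_vector (h : IsSaddleSplitting φ Λ Es Eu) {x : M}
    (hx : x ∈ Λ) : ∃ v ∈ Es x, v ≠ 0 ∧ ∀ w ∈ Es x, ∃ a : ℝ, w = a • v := by
  obtain ⟨⟨u, hu⟩, hu0, hspan⟩ := finrank_eq_one_iff'.1 (h.finrank_stable x hx)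
  refine ⟨u, hu, fun h0 => hu0 (Subtype.ext h0), fun w hw => ?_⟩
  obtain ⟨a, ha⟩ := hspan ⟨w, hw⟩
  exact ⟨a, (congrArg Subtype.val ha).symm⟩

/-- A function whose differential does not vanish on the stable line at `p` has a differential
bounded below on the nearby stable lines. -/
lemma IsSaddleSplitting.eventually_norm_le_abs_differential (h : IsSaddleSplitting φ Λ Es Eu)
    (hΛ : φ '' Λ = Λ) {f : M → ℝ} (hf : ContMDiff (𝓡 2) 𝓘(ℝ, ℝ) 2 f) {p : M} (hp : p ∈ Λ)
    (hfp : ∃ v ∈ Es p, differential f p v ≠ 0) :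
    ∃ C, ∀ᶠ y in 𝓝[Λ] p, ∀ v ∈ Es y, ‖v‖ ≤ C * |differential f y v| := by
  obtain ⟨n, e, he, -, hinj⟩ := exists_embedding_euclidean_of_compact (I := 𝓡 2) (M := M)
  have he2 : ContMDiff (𝓡 2) 𝓘(ℝ, EuclideanSpace ℝ (Fin n)) 2 e :=
    he.of_le ENat.LEInfty.out
  have he1 := he2.of_le (one_le_two (α := ℕ∞ω))
  have hf1 := hf.of_le (one_le_two (α := ℕ∞ω))
  -- Adjoining `f` to an embedding keeps it an immersion and makes `df` a covector of the form `β ∘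
  -- dG`.
  have hG : ContMDiff (𝓡 2) 𝓘(ℝ, EuclideanSpace ℝ (Fin n) × ℝ) 2 (fun x => (e x, f x)) :=
    he2.prodMk_space hf
  have hGinj : ∀ x, Function.Injective (differential (fun x => (e x, f x)) x) := by
    intro x v w hvw
    rw [differential_prodMk he1 hf1, differential_prodMk he1 hf1] at hvw
    exact hinj x (congrArg Prod.fst hvw)
  obtain ⟨A, hA, hLip⟩ := h.exists_lipschitz hΛ hG hGinj
  obtain ⟨c, hc, hlow⟩ := exists_norm_le_norm_differential (hG.of_le one_le_two) hGinj
  obtain ⟨v₀, hv₀, hv₀0⟩ := hfp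
  obtain ⟨u, hu, -, hspan⟩ := h.exists_stable_vector hp
  have hfu : differential f p u ≠ 0 := by
    obtain ⟨a, rfl⟩ := hspan v₀ hv₀
    intro h0
    exact hv₀0 (by rw [map_smul, h0, smul_zero])
  set G : M → EuclideanSpace ℝ (Fin n) × ℝ := fun x => (e x, f x) with hGdef
  have hsnd : ∀ x v, (differential G x v).2 = differential f x v := fun x v => by
    rw [hGdef, differential_prodMk he1 hf1]
  set T := ‖differential G p u‖ / |differential f p u| with hT
  have hT0 : 0 ≤ T := by positivity
  -- Makes the Lipschitz error at most half of the norm of `dG v`.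
  set s := 1 / (2 * (A * (1 + T) * c + 1)) with hs
  have hs0 : 0 < s := by positivity
  refine ⟨c * (2 * T), ?_⟩
  filter_upwards [mem_nhdsWithin_of_mem_nhds (Metric.eball_mem_nhds p (ENNReal.ofReal_pos.2 hs0)),
    self_mem_nhdsWithin] with y hy hyΛ v hv
  have hpy : edist p y < ENNReal.ofReal s := by rw [edist_comm]; exact hy
  obtain ⟨γ, hγ1, hγ⟩ := exists_dual_vector'' ℝ (differential G y v)
  have hγ' : γ (differential G y v) = ‖differential G y v‖ := hγ
  -- The multiple for which `γ ∘ dG - τ df` vanishes on the stable line at `p`. It is then small on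
  -- the stable line at `y`, so `τ df` must account for at least half of the norm of `dG v`.
  set τ := γ (differential G p u) / differential f p u with hτ
  have hτT : |τ| ≤ T := by
    rw [hτ, abs_div, hT]
    gcongr
    exact (γ.le_opNorm _).trans (mul_le_of_le_one_left (norm_nonneg _) hγ1)
  set β := γ - τ • ContinuousLinearMap.snd ℝ (EuclideanSpace ℝ (Fin n)) ℝ with hβ
  have hβn : ‖β‖ ≤ 1 + T := by
    refine (norm_sub_le _ _).trans (add_le_add hγ1 ?_)
    rw [norm_smul]
    exact (mul_le_of_le_one_right (norm_nonneg _) (ContinuousLinearMap.norm_snd_le _ _ _)).trans hτT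
  have hβa : ∀ x w, β (differential G x w) = γ (differential G x w) - τ * differential f x w := by
    intro x w
    rw [← hsnd]
    rfl
  have key := hLip p hp y hyΛ s hpy β (fun w hw => by
    obtain ⟨a, rfl⟩ := hspan w hw
    rw [map_smul, map_smul, hβa, hτ, div_mul_cancel₀ _ hfu, sub_self, smul_zero]) v hv
  rw [hβa, hγ'] at key
  have h1 : A * s * ‖β‖ * ‖v‖ ≤ 1 / 2 * ‖differential G y v‖ := by
    calc A * s * ‖β‖ * ‖v‖ ≤ A * s * (1 + T) * (c * ‖differential G y v‖) := by
          gcongr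
          exact hlow y v
      _ = A * (1 + T) * c * s * ‖differential G y v‖ := by ring
      _ ≤ 1 / 2 * ‖differential G y v‖ := by
          gcongr
          rw [hs, mul_one_div, div_le_div_iff₀ (by positivity) (by norm_num)]
          linarith
  have h2 : τ * differential f y v ≤ T * |differential f y v| := by
    refine (le_abs_self _).trans ?_
    rw [abs_mul]
    gcongr
  have h3 : ‖differential G y v‖ ≤ 2 * T * |differential f y v| := by
    linarith [le_abs_self (‖differential G y v‖ - τ * differential f y v)]
  exact (hlow y v).trans (by rw [mul_assoc]; gcongr)

/-- Compactness makes the lower bound on `df` uniform, and a smaller perturbation of the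
differential cannot cancel it. -/
lemma IsSaddleSplitting.isOpen_transversalFunctions (h : IsSaddleSplitting φ Λ Es Eu)
    (hΛ : φ '' Λ = Λ) (hr : 2 ≤ r) {S : Set M} (hS : IsCompact S) (hSΛ : S ⊆ Λ) :
    IsOpen[crTopology M r] (transversalFunctions r S Es) := by
  let := crTopology M r
  have hr' : (2 : ℕ∞ω) ≤ r := WithTop.coe_le_coe.2 hr
  refine isOpen_iff_mem_nhds.2 fun f hf => ?_
  obtain ⟨C, hC⟩ := exists_forall_of_eventually hS
    (P := fun y C => ∀ v ∈ Es y, ‖v‖ ≤ C * |differential f y v|)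
    (fun x C C' hCC' hx v hv => (hx v hv).trans (by gcongr))
    (fun x hx => by
      obtain ⟨C, hC⟩ := h.eventually_norm_le_abs_differential hΛ (f.contMDiff.of_le hr') (hSΛ hx)
        (hf x hx)
      exact ⟨C, hC.filter_mono (nhdsWithin_mono x hSΛ)⟩)
  have hC1 : 0 < |C| + 1 := by positivity
  filter_upwards [setOf_differential_sub_le_mem_nhds (one_le_two.trans hr) f
    (show 0 < 1 / (2 * (|C| + 1)) by positivity)] with g hg x hx
  obtain ⟨v, hv, hv0, -⟩ := h.exists_stable_vector (hSΛ hx)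
  refine ⟨v, hv, fun h0 => ?_⟩
  have h1 := hg x v
  rw [h0, zero_sub, abs_neg] at h1
  have h2 := hC x hx v hv
  have h3 : 0 < ‖v‖ := norm_pos_iff.2 hv0
  have h4 : ‖v‖ ≤ (|C| + 1) * (1 / (2 * (|C| + 1)) * ‖v‖) := by
    refine h2.trans (mul_le_mul ?_ h1 (abs_nonneg _) hC1.le)
    linarith [le_abs_self C]
  have h5 : (|C| + 1) * (1 / (2 * (|C| + 1)) * ‖v‖) = ‖v‖ / 2 := by field_simp
  linarith

/-- If the differential of `g` is bounded below on the stable lines over a subset `S` of `Λ` of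
dimension less than one, then every function is made transversal to these lines by subtracting
arbitrarily small multiples of `g`. -/
lemma IsSaddleSplitting.dense_transversalFunctions_of_norm_le (h : IsSaddleSplitting φ Λ Es Eu)
    (hΛ : φ '' Λ = Λ) (hr : 2 ≤ r) {S : Set M} (hSΛ : S ⊆ Λ) (hdim : dimH S < 1)
    (g : C^r⟮𝓡 2, M; 𝓘(ℝ, ℝ), ℝ⟯) {C : ℝ} (hC0 : 0 ≤ C)
    (hC : ∀ y ∈ S, ∀ v ∈ Es y, ‖v‖ ≤ C * |differential g y v|) :
    @Dense _ (crTopology M r) (transversalFunctions r S Es) := by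
  let := crTopology M r
  intro f
  have hr' : (2 : ℕ∞ω) ≤ r := WithTop.coe_le_coe.2 hr
  have hf2 : ContMDiff (𝓡 2) 𝓘(ℝ, ℝ) 2 f := f.contMDiff.of_le hr'
  have hg2 : ContMDiff (𝓡 2) 𝓘(ℝ, ℝ) 2 g := g.contMDiff.of_le hr'
  have hf1 := hf2.of_le (one_le_two (α := ℕ∞ω))
  have hg1 := hg2.of_le (one_le_two (α := ℕ∞ω))
  obtain ⟨n, e, he, -, hinj⟩ := exists_embedding_euclidean_of_compact (I := 𝓡 2) (M := M)
  have he2 : ContMDiff (𝓡 2) 𝓘(ℝ, EuclideanSpace ℝ (Fin n)) 2 e :=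
    he.of_le ENat.LEInfty.out
  have he1 := he2.of_le (one_le_two (α := ℕ∞ω))
  have hfg : ContMDiff (𝓡 2) 𝓘(ℝ, ℝ × ℝ) 2 (fun x => (f x, g x)) := hf2.prodMk_space hg2
  have hfg1 := hfg.of_le (one_le_two (α := ℕ∞ω))
  have hG : ContMDiff (𝓡 2) 𝓘(ℝ, EuclideanSpace ℝ (Fin n) × ℝ × ℝ) 2
    (fun x => (e x, f x, g x)) := he2.prodMk_space hfg
  set G : M → EuclideanSpace ℝ (Fin n) × ℝ × ℝ := fun x => (e x, f x, g x) with hGdef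
  have hGd : ∀ x v, differential G x v =
      (differential e x v, differential f x v, differential g x v) := fun x v => by
    rw [hGdef, differential_prodMk he1 hfg1, differential_prodMk hf1 hg1]
  have hGinj : ∀ x, Function.Injective (differential G x) := by
    intro x v w hvw
    rw [hGd, hGd] at hvw
    exact hinj x (congrArg Prod.fst hvw)
  obtain ⟨A, hA, hLip⟩ := h.exists_lipschitz hΛ hG hGinj
  obtain ⟨B, hB, hfB⟩ := exists_norm_differential_le hf1
  choose! u hu hu0 hspan using fun x (hx : x ∈ S) => h.exists_stable_vector (hSΛ hx)
  have hgu : ∀ x ∈ S, differential g x (u x) ≠ 0 := by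
    intro x hx h0
    have := hC x hx _ (hu x hx)
    rw [h0, abs_zero, mul_zero] at this
    exact hu0 x hx (norm_le_zero_iff.1 this)
  -- The only `τ` for which the differential of `f - τ g` vanishes on the stable line at `x`.
  let t : M → ℝ := fun x => differential f x (u x) / differential g x (u x)
  have htB : ∀ x ∈ S, |t x| ≤ B * C := by
    intro x hx
    rw [abs_div, div_le_iff₀ (abs_pos.2 (hgu x hx)), mul_assoc]
    exact (hfB x (u x)).trans (mul_le_mul_of_nonneg_left (hC x hx _ (hu x hx)) hB)
  have htlip : LipschitzOnWith (A * (1 + B * C) * C + 1).toNNReal t S := by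
    refine lipschitzOnWith_of_forall_edist_lt (by positivity) fun x hx y hy s hs => ?_
    have hs0 := pos_of_edist_lt_ofReal hs
    set P := ContinuousLinearMap.snd ℝ (EuclideanSpace ℝ (Fin n)) (ℝ × ℝ)
    -- `β ∘ dG = df - t(x) dg` kills the stable line at `x`, and at `u y` it equals `(t(y) - t(x))
    -- dg`; the lower bound on `dg` then bounds `t(y) - t(x)`.
    set β : EuclideanSpace ℝ (Fin n) × ℝ × ℝ →L[ℝ] ℝ :=
      (ContinuousLinearMap.fst ℝ ℝ ℝ - t x • ContinuousLinearMap.snd ℝ ℝ ℝ).comp P with hβ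
    have hβa : ∀ z w, β (differential G z w) = differential f z w - t x * differential g z w := by
      intro z w
      rw [hGd]
      rfl
    have hβn : ‖β‖ ≤ 1 + B * C := by
      refine (ContinuousLinearMap.opNorm_comp_le _ _).trans
        ((mul_le_of_le_one_right (norm_nonneg _) (ContinuousLinearMap.norm_snd_le _ _ _)).trans ?_)
      refine (norm_sub_le _ _).trans (add_le_add (ContinuousLinearMap.norm_fst_le _ _ _) ?_)
      rw [norm_smul]
      exact (mul_le_of_le_one_right (norm_nonneg _)
        (ContinuousLinearMap.norm_snd_le _ _ _)).trans (htB x hx)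
    have key := hLip x (hSΛ hx) y (hSΛ hy) s hs β (fun w hw => by
      obtain ⟨a, rfl⟩ := hspan x hx w hw
      rw [map_smul, map_smul, hβa, div_mul_cancel₀ _ (hgu x hx), sub_self, smul_zero])
      (u y) (hu y hy)
    have hfy : differential f y (u y) = t y * differential g y (u y) :=
      (div_mul_cancel₀ _ (hgu y hy)).symm
    rw [hβa, hfy, ← sub_mul, abs_mul] at key
    have hpos := abs_pos.2 (hgu y hy)
    rw [abs_sub_comm]
    refine le_of_mul_le_mul_right (key.trans ?_) hpos
    calc A * s * ‖β‖ * ‖u y‖ ≤ A * s * (1 + B * C) * (C * |differential g y (u y)|) := by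
          gcongr
          exact hC y hy _ (hu y hy)
      _ = A * (1 + B * C) * C * s * |differential g y (u y)| := by ring
  have hdense : Dense (t '' S)ᶜ := by
    refine dense_compl_of_dimH_lt_finrank (htlip.dimH_image_le.trans_lt ?_)
    simpa using hdim
  have hcl : f - (0 : ℝ) • g ∈ closure (transversalFunctions r S Es) := by
    refine map_mem_closure (f := fun τ : ℝ => f - τ • g) (continuous_sub_smul_crTopology f g) (hdense 0) fun τ hτ x hx => ?_
    refine ⟨u x, hu x hx, fun h0 => hτ ⟨x, hx, ?_⟩⟩
    have h1 := differential_clm_comp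
      (ContinuousLinearMap.fst ℝ ℝ ℝ - τ • ContinuousLinearMap.snd ℝ ℝ ℝ) hfg1 x (u x)
    rw [differential_prodMk hf1 hg1] at h1
    have h2 : differential (f - τ • g : C^r⟮𝓡 2, M; 𝓘(ℝ, ℝ), ℝ⟯) x (u x) =
      differential f x (u x) - τ * differential g x (u x) := h1
    rw [h0] at h2
    exact (div_eq_iff (hgu x hx)).2 (by linarith)
  rwa [zero_smul, sub_zero] at hcl

/-- A suitable `g` exists only locally. Density passes to finite unions because over compact pieces
the transversal sets are also open; hence the compact set `T` in the induction. -/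
lemma IsSaddleSplitting.dense_transversalFunctions (h : IsSaddleSplitting φ Λ Es Eu)
    (hΛ : φ '' Λ = Λ) (hc : IsCompact Λ) (hr : 2 ≤ r) (hdim : dimH Λ < 1) :
    @Dense _ (crTopology M r) (transversalFunctions r Λ Es) := by
  let := crTopology M r
  have hr' : (2 : ℕ∞ω) ≤ r := WithTop.coe_le_coe.2 hr
  suffices ∃ T, Λ ⊆ T ∧ T ⊆ Λ ∧ IsCompact T ∧ Dense (transversalFunctions r T Es) by
    obtain ⟨T, h1, h2, -, h3⟩ := this
    rwa [subset_antisymm h1 h2]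
  refine hc.induction_on (p := fun s => ∃ T, s ⊆ T ∧ T ⊆ Λ ∧ IsCompact T ∧
    Dense (transversalFunctions r T Es)) ?_ ?_ ?_ ?_
  · refine ⟨∅, subset_rfl, empty_subset _, isCompact_empty, ?_⟩
    have : transversalFunctions r ∅ Es = univ := eq_univ_of_forall fun f x hx => hx.elim
    rw [this]
    exact dense_univ
  · rintro s s' hss' ⟨T, h1, h2⟩
    exact ⟨T, hss'.trans h1, h2⟩
  · rintro s s' ⟨T, h1, h2, h3, h4⟩ ⟨T', h1', h2', h3', h4'⟩
    refine ⟨T ∪ T', union_subset_union h1 h1', union_subset h2 h2', h3.union h3', ?_⟩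
    refine (h4.inter_of_isOpen_left h4' (h.isOpen_transversalFunctions hΛ hr h3 h2)).mono ?_
    rintro f ⟨hf, hf'⟩ x (hx | hx)
    · exact hf x hx
    · exact hf' x hx
  intro p hp
  obtain ⟨n, e, he, -, hinj⟩ := exists_embedding_euclidean_of_compact (I := 𝓡 2) (M := M)
  have he1 : ContMDiff (𝓡 2) 𝓘(ℝ, EuclideanSpace ℝ (Fin n)) 1 e := he.of_le (by simp)
  obtain ⟨v, hv, hv0, -⟩ := h.exists_stable_vector hp
  have hev : differential e p v ≠ 0 := fun h0 => hv0 (hinj p (h0.trans (map_zero _).symm))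
  -- Some coordinate of the embedding has nonzero differential on the stable line at `p`; it serves
  -- as `g`.
  obtain ⟨i, hi⟩ : ∃ i, differential e p v i ≠ 0 := by
    by_contra! hcon
    exact hev (PiLp.ext hcon)
  have hg : ContMDiff (𝓡 2) 𝓘(ℝ, ℝ) r fun x => EuclideanSpace.proj (𝕜 := ℝ) i (e x) :=
    (EuclideanSpace.proj (𝕜 := ℝ) i).contMDiff.comp (he.of_le (by exact_mod_cast le_top))
  let g : C^r⟮𝓡 2, M; 𝓘(ℝ, ℝ), ℝ⟯ := ⟨_, hg⟩
  have hgv : differential g p v ≠ 0 := by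
    have := differential_clm_comp (EuclideanSpace.proj (𝕜 := ℝ) i) he1 p v
    exact fun h0 => hi (this.symm.trans h0)
  obtain ⟨C, hC⟩ := h.eventually_norm_le_abs_differential hΛ (hg.of_le hr') hp ⟨v, hv, hgv⟩
  obtain ⟨W, hW, hWc, hWs⟩ := exists_mem_nhds_isClosed_subset (mem_nhdsWithin_iff_eventually.1 hC)
  refine ⟨Λ ∩ W, inter_mem_nhdsWithin _ hW, Λ ∩ W, subset_rfl, inter_subset_left,
    hc.inter_right hWc, ?_⟩
  refine h.dense_transversalFunctions_of_norm_le hΛ hr inter_subset_left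
    ((dimH_mono inter_subset_left).trans_lt hdim) g (abs_nonneg C) fun y hy w hw => ?_
  exact (hWs hy.2 hy.1 w hw).trans
    (mul_le_mul_of_nonneg_right (le_abs_self C) (abs_nonneg _))

omit [CompactSpace M] [IsManifold (𝓡 2) ∞ M] [IsRiemannianManifold (𝓡 2) M]
  [IsContinuousRiemannianBundle (EuclideanSpace ℝ (Fin 2))
    (fun x : M => TangentSpace (𝓡 2) x)] in
lemma gradientAt_notMem_orthogonal_iff {f : M → ℝ} {x : M}
    {V : Submodule ℝ (TangentSpace (𝓡 2) x)} :
    gradientAt f x ∉ Vᗮ ↔ ∃ v ∈ V, differential f x v ≠ 0 := by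
  have : FiniteDimensional ℝ (TangentSpace (𝓡 2) x) :=
    inferInstanceAs (FiniteDimensional ℝ (EuclideanSpace ℝ (Fin 2)))
  have : CompleteSpace (TangentSpace (𝓡 2) x) := FiniteDimensional.complete ℝ _
  have h : ∀ v, inner ℝ (gradientAt f x) v = differential f x v := fun v =>
    InnerProductSpace.toDual_symm_apply
  rw [Submodule.mem_orthogonal']
  simp only [h]
  push Not
  rfl

omit [CompactSpace M] [IsManifold (𝓡 2) ∞ M] [IsRiemannianManifold (𝓡 2) M]
  [IsContinuousRiemannianBundle (EuclideanSpace ℝ (Fin 2))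
    (fun x : M => TangentSpace (𝓡 2) x)] in
lemma nonPerpendicularFunctions_eq_inter :
    nonPerpendicularFunctions r Λ Es Eu =
      transversalFunctions r Λ Es ∩ transversalFunctions r Λ Eu := by
  ext f
  simp only [nonPerpendicularFunctions, mem_ofPred_eq, gradientAt_notMem_orthogonal_iff,
    transversalFunctions, mem_inter_iff]
  exact forall₂_and

end Transversality

end SurfaceHorseshoe

end

/-! ### Both families of lines together. -/

open SurfaceHorseshoe in
theorem propositionp {M : Type*} [EMetricSpace M] [CompactSpace M]
    [ChartedSpace (EuclideanSpace ℝ (Fin 2)) M] [IsManifold (𝓡 2) ∞ M]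
    [RiemannianBundle (fun x : M => TangentSpace (𝓡 2) x)]
    [IsContMDiffRiemannianBundle (𝓡 2) ∞ (EuclideanSpace ℝ (Fin 2))
      (fun x : M => TangentSpace (𝓡 2) x)]
    [IsRiemannianManifold (𝓡 2) M]
    (r : ℕ∞) (hr : 2 ≤ r)
    (φ : M ≃ₘ^2⟮𝓡 2, 𝓡 2⟯ M) (Λ : Set M) (hΛ : IsHorseshoe φ Λ)
    (Es Eu : (x : M) → Submodule ℝ (TangentSpace (𝓡 2) x)) (hE : IsSaddleSplitting φ Λ Es Eu)
    (hdim : dimH Λ < 1) :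
    IsOpen[crTopology M r] (nonPerpendicularFunctions r Λ Es Eu) ∧
      @Dense _ (crTopology M r) (nonPerpendicularFunctions r Λ Es Eu) := by
  have : IsContinuousRiemannianBundle (EuclideanSpace ℝ (Fin 2))
      (fun x : M => TangentSpace (𝓡 2) x) := by
    obtain ⟨g, hg, hinner⟩ := IsContMDiffRiemannianBundle.exists_contMDiff (IB := 𝓡 2) (n := ∞)
      (F := EuclideanSpace ℝ (Fin 2)) (E := fun x : M => TangentSpace (𝓡 2) x)
    exact ⟨g, hg.continuous, hinner⟩
  have hE' := hE.symm hΛ.invariant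
  have hinv : φ.symm '' Λ = Λ := by
    nth_rewrite 1 [← hΛ.invariant]
    rw [Set.image_image]
    simp
  let := crTopology M r
  have ho := hE.isOpen_transversalFunctions hΛ.invariant hr hΛ.isCompact subset_rfl
  have ho' := hE'.isOpen_transversalFunctions hinv hr hΛ.isCompact subset_rfl
  have hd := hE.dense_transversalFunctions hΛ.invariant hΛ.isCompact hr hdim
  have hd' := hE'.dense_transversalFunctions hinv hΛ.isCompact hr hdim
  rw [nonPerpendicularFunctions_eq_inter]
  exact ⟨ho.inter ho', hd.inter_of_isOpen_left hd' ho⟩
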